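/- Let $\lambda\ge 1$. There is a constant $0<c_H<1$, depending only on $\lambda$, and for all $C_d,C_P>0$ there is a constant $C$, depending only on $C_d,C_P,\lambda$, such that the following holds. Let $(X,d)$ be a complete metric space with a Borel regular measure $\mu$ that is doubling with constant $C_d$, i.e. $0<\mu(B(x,2r))\le C_d\,\mu(B(x,r))<\infty$ for all balls, and that supports a $(1,1)$-Poincaré inequality with constants $C_P,\lambda$, i.e. $$\frac1{\mu(B(x,r))}\int_{B(x,r)}|u-u_{B(x,r)}|\,d\mu\le C_P\,r\,\frac1{\mu(B(x,\lambda r))}\int_{B(x,\lambda r)}g\,d\mu$$ for every ball $B(x,r)$, every $u\in L^1_{\rm loc}(X)$ and every upper gradient $g$ of $u$, where $u_{B}$ is the mean value of $u$ over $B$. Let $\Omega\subset X$ be a nonempty open set such that $\mu|_\Omega$ is doubling, i.e. for some $c_d>0$, $0<\mu(B(x,2r)\cap\Omega)\le c_d\,\mu(B(x,r)\cap\Omega)<\infty$ for all $x\in\overline\Omega$, $r>0$. Let $\widetilde{\mathcal H}$ be any Radon measure on $\partial\Omega$, let $u\in N^{1,1}(\Omega)$, and let $Tu:\partial\Omega\to\mathbb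 R$ be such that $$\lim_{r\to0^+}\frac1{\mu(B(x,r)\cap\Omega)}\int_{B(x,r)\cap\Omega}|u-Tu(x)|\,d\mu=0\quad\text{for }\widetilde{\mathcal H}\text{-a.e. }x\in\partial\Omega.$$ Then there is $v\in M^{1,1}_{c_H}(\Omega)\cap\mathrm{Lip}_{\rm loc}(\Omega)$ with $\|v\|_{M^{1,1}_{c_H}(\Omega)}\le C\|u\|_{N^{1,1}(\Omega)}$ and $$\lim_{r\to0^+}\frac1{\mu(B(x,r)\cap\Omega)}\int_{B(x,r)\cap\Omega}|v-Tu(x)|\,d\mu=0\quad\text{for }\widetilde{\mathcal H}\text{-a.e. }x\in\partial\Omega.$$ If in addition $\Omega$ is a uniform domain with constant $c_U$, then this $v$ also belongs to $M^{1,1}(\Omega)$, with $\|v\|_{M^{1,1}(\Omega)}\le C'\|u\|_{N^{1,1}(\Omega)}$, where $C'$ depends only on $C_d,C_P,\lambda,c_U$. Here curves are rectifiable. A Borel function $g\ge0$ on $X$ is an upper gradient of $u:X\to[-\infty,\infty]$ if $|u(x)-u(y)|\le\int_\gamma g\,ds$ for every nonconstant curve $\gamma$ with end points $x,y$ (the left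 side being $\infty$ if $u(x)$ or $u(y)$ is infinite). A $\mu$-measurable $g\ge0$ is a $1$-weak upper gradient of $u$ in $\Omega$ if there is a Borel $\rho\ge 0$ in $L^1(X)$ such that this inequality holds for every nonconstant curve $\gamma$ in $\Omega$ with $\int_\gamma\rho\,ds<\infty$. $N^{1,1}(\Omega)$ is the set of $\mu$-measurable $u:\Omega\to[-\infty,\infty]$ with $\|u\|_{N^{1,1}(\Omega)}=\|u\|_{L^1(\Omega)}+\inf_g\|g\|_{L^1(\Omega)}<\infty$, the infimum being over all $1$-weak upper gradients $g$ of $u$ in $\Omega$. $M^{1,1}(\Omega)$ is the set of $v\in L^1(\Omega)$ for which there are $0\le g\in L^1(\Omega)$ and a null set $A$ with $|v(x)-v(y)|\le d(x,y)(g(x)+g(y))$ for all $x,y\in\Omega\setminus A$, with norm $\|v\|_{L^1(\Omega)}+\inf_g\|g\|_{L^1(\Omega)}$ over all such $g$. $M^{1,1}_{c_H}(\Omega)$ and its norm are defined in the same way, the inequality being required only when $d(x,y)\le c_H\min\{d(x,X\setminus\Omega),d(y,X\setminus\Omega)\}$ (with $d(x,\emptyset)=\infty$). $v\in\mathrm{Lip}_{\rm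 loc}(\Omega)$ means that $v$ is real valued and Lipschitz on each open $\Omega'$ whose closure is a compact subset of $\Omega$. Finally, $\Omega$ is a uniform domain with constant $c_U\in(0,1]$ if any two distinct $x,y\in\Omega$ are joined by an arc-length parametrized curve $\gamma:[0,\ell]\to\Omega$ with $\ell\le c_U^{-1}d(x,y)$ and $d(\gamma(t),X\setminus\Omega)\ge c_U\min\{t,\ell-t\}$ for all $t\in[0,\ell]$. -/

import Mathlib

open MeasureTheory Set Filter Topology
open scoped NNReal ENNReal

namespace MetricTrace

variable {X : Type*} [MetricSpace X] [MeasurableSpace X]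

/-- `μ` is doubling with constant `Cd`:
`0 < μ(B(x,2r)) ≤ Cd μ(B(x,r)) < ∞` for every (open) ball. -/
def IsDoubling (μ : Measure X) (Cd : ℝ≥0) : Prop :=
  ∀ (x : X) (r : ℝ), 0 < r →
    0 < μ (Metric.ball x (2 * r)) ∧
    μ (Metric.ball x (2 * r)) ≤ Cd * μ (Metric.ball x r) ∧
    μ (Metric.ball x r) < ∞

/-- The measure doubling condition for `Ω`:
`0 < μ(B(x,2r) ∩ Ω) ≤ c μ(B(x,r) ∩ Ω) < ∞` for every `x` in the closure of `Ω` and `r > 0`. -/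
def IsDoublingOn (μ : Measure X) (Ω : Set X) : Prop :=
  ∃ c : ℝ≥0, ∀ x ∈ closure Ω, ∀ r : ℝ, 0 < r →
    0 < μ (Metric.ball x (2 * r) ∩ Ω) ∧
    μ (Metric.ball x (2 * r) ∩ Ω) ≤ c * μ (Metric.ball x r ∩ Ω) ∧
    μ (Metric.ball x r ∩ Ω) < ∞

/-- A nonconstant rectifiable curve contained in `A`, given through its arc-length
parametrization `γ : [0, ℓ] → A`, `ℓ > 0`: for all `0 ≤ s ≤ t ≤ ℓ` the restriction of `γ` to
`[s, t]` has length `t - s`.  Every nonconstant rectifiable curve has such a parametrization, and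
curve integrals and end points depend on nothing else. The values of `γ` off `[0, ℓ]` are
irrelevant. -/
structure IsCurveIn (A : Set X) (γ : ℝ → X) (ℓ : ℝ) : Prop where
  length_pos : 0 < ℓ
  unit_speed : HasUnitSpeedOn γ (Icc 0 ℓ)
  mapsTo : MapsTo γ (Icc 0 ℓ) A

/-- The curve integral `∫_γ g ds` of a nonnegative function along an arc-length parametrized
curve. -/
noncomputable def lineIntegral (g : X → ℝ≥0∞) (γ : ℝ → X) (ℓ : ℝ) : ℝ≥0∞ :=
  ∫⁻ t in Icc 0 ℓ, g (γ t)

/-- The upper gradient inequality `|u(x) - u(y)| ≤ ∫_γ g ds` at the end points of a curve.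
Note that `(a - b).abs = ∞` in `EReal` as soon as `a` or `b` is infinite. -/
def UpperGradientIneq (u : X → EReal) (g : X → ℝ≥0∞) (γ : ℝ → X) (ℓ : ℝ) : Prop :=
  (u (γ 0) - u (γ ℓ)).abs ≤ lineIntegral g γ ℓ

/-- `g` is an upper gradient of `u` in `X`. -/
def IsUpperGradient (u : X → EReal) (g : X → ℝ≥0∞) : Prop :=
  Measurable g ∧ ∀ (γ : ℝ → X) (ℓ : ℝ), IsCurveIn univ γ ℓ → UpperGradientIneq u g γ ℓ

/-- A family of curves (pairs of an arc-length parametrization and its length) has zero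
`1`-modulus: there is a nonnegative Borel function `ρ ∈ L¹(X)` whose integral along each curve of
the family is infinite. -/
def ZeroModulus (μ : Measure X) (Γ : Set ((ℝ → X) × ℝ)) : Prop :=
  ∃ ρ : X → ℝ≥0∞, Measurable ρ ∧ ∫⁻ x, ρ x ∂μ < ∞ ∧ ∀ c ∈ Γ, lineIntegral ρ c.1 c.2 = ∞

/-- `g` is a `1`-weak upper gradient of `u` in `H`: it is a nonnegative `μ`-measurable function
and the upper gradient inequality holds for `1`-almost every curve in `H`. -/
def IsWeakUpperGradientOn (μ : Measure X) (H : Set X) (u : X → EReal) (g : X → ℝ≥0∞) : Prop :=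
  AEMeasurable g (μ.restrict H) ∧
    ZeroModulus μ {c | IsCurveIn H c.1 c.2 ∧ ¬ UpperGradientIneq u g c.1 c.2}

/-- `u ∈ L¹(H)` for an extended real valued function `u`. -/
def MemL1 (μ : Measure X) (H : Set X) (u : X → EReal) : Prop :=
  AEMeasurable u (μ.restrict H) ∧ ∫⁻ x in H, (u x).abs ∂μ < ∞

/-- `u ∈ L¹_loc(X)`: `u` is in `L¹(U)` for every open `U` with compact closure. -/
def MemL1Loc (μ : Measure X) (u : X → EReal) : Prop :=
  ∀ U : Set X, IsOpen U → IsCompact (closure U) → MemL1 μ U u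

/-- The `(1,1)`-Poincaré inequality with constants `CP` and `lam`. -/
def SupportsPoincare (μ : Measure X) (CP : ℝ≥0) (lam : ℝ) : Prop :=
  ∀ (x : X) (r : ℝ), 0 < r → ∀ (u : X → EReal) (g : X → ℝ≥0∞),
    MemL1Loc μ u → IsUpperGradient u g →
    ⨍⁻ y in Metric.ball x r,
        (u y - ((⨍ z in Metric.ball x r, (u z).toReal ∂μ : ℝ) : EReal)).abs ∂μ
      ≤ CP * ENNReal.ofReal r * ⨍⁻ y in Metric.ball x (lam * r), g y ∂μ

/-- The Newton-Sobolev norm `‖u‖_{L¹(H)} + inf ‖g‖_{L¹(H)}`, the infimum being over all `1`-weak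
upper gradients `g` of `u` in `H` (`∞` if there is none). -/
noncomputable def normN11 (μ : Measure X) (H : Set X) (u : X → EReal) : ℝ≥0∞ :=
  (∫⁻ x in H, (u x).abs ∂μ) +
    ⨅ (g : X → ℝ≥0∞) (_ : IsWeakUpperGradientOn μ H u g), ∫⁻ x in H, g x ∂μ

/-- `u ∈ N^{1,1}(H)`; only the values of `u` in `H` matter. -/
def MemN11 (μ : Measure X) (H : Set X) (u : X → EReal) : Prop :=
  AEMeasurable u (μ.restrict H) ∧ normN11 μ H u < ∞

/-- `g` is admissible in the definition of the Hajłasz-Sobolev space `M^{1,1}(K)`: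
`|v(x) - v(y)| ≤ d(x,y) (g(x) + g(y))` for all `x, y ∈ K` off a null set. -/
def IsHajlaszGradient (μ : Measure X) (K : Set X) (v : X → ℝ) (g : X → ℝ≥0∞) : Prop :=
  AEMeasurable g (μ.restrict K) ∧ ∃ A : Set X, μ A = 0 ∧
    ∀ x ∈ K \ A, ∀ y ∈ K \ A, ‖v x - v y‖ₑ ≤ edist x y * (g x + g y)

/-- `g` is admissible in the definition of `M^{1,1}_c(K)`: the Hajłasz inequality is only
required when `d(x,y) ≤ c min {d(x, X \ K), d(y, X \ K)}`, where `d(x, ∅) = ∞`. -/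
def IsLocalHajlaszGradient (μ : Measure X) (c : ℝ) (K : Set X) (v : X → ℝ) (g : X → ℝ≥0∞) :
    Prop :=
  AEMeasurable g (μ.restrict K) ∧ ∃ A : Set X, μ A = 0 ∧
    ∀ x ∈ K \ A, ∀ y ∈ K \ A,
      edist x y ≤ ENNReal.ofReal c * min (Metric.infEDist x Kᶜ) (Metric.infEDist y Kᶜ) →
      ‖v x - v y‖ₑ ≤ edist x y * (g x + g y)

/-- The norm of `M^{1,1}(K)`. -/
noncomputable def normM11 (μ : Measure X) (K : Set X) (v : X → ℝ) : ℝ≥0∞ :=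
  (∫⁻ x in K, ‖v x‖ₑ ∂μ) +
    ⨅ (g : X → ℝ≥0∞) (_ : IsHajlaszGradient μ K v g), ∫⁻ x in K, g x ∂μ

/-- The norm of `M^{1,1}_c(K)`. -/
noncomputable def normM11Local (μ : Measure X) (c : ℝ) (K : Set X) (v : X → ℝ) : ℝ≥0∞ :=
  (∫⁻ x in K, ‖v x‖ₑ ∂μ) +
    ⨅ (g : X → ℝ≥0∞) (_ : IsLocalHajlaszGradient μ c K v g), ∫⁻ x in K, g x ∂μ

/-- `v ∈ M^{1,1}(K)`, for a real valued function `v`. -/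
def MemM11 (μ : Measure X) (K : Set X) (v : X → ℝ) : Prop :=
  AEMeasurable v (μ.restrict K) ∧ normM11 μ K v < ∞

/-- `v ∈ M^{1,1}_c(K)`, for a real valued function `v`. -/
def MemM11Local (μ : Measure X) (c : ℝ) (K : Set X) (v : X → ℝ) : Prop :=
  AEMeasurable v (μ.restrict K) ∧ normM11Local μ c K v < ∞

/-- `v ∈ Lip_loc(Ω)`: `v` is Lipschitz on every open `U` whose closure is a compact subset
of `Ω`. -/
def MemLipLoc {X : Type*} [MetricSpace X] (Ω : Set X) (v : X → ℝ) : Prop :=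
  ∀ U : Set X, IsOpen U → IsCompact (closure U) → closure U ⊆ Ω →
    ∃ L : ℝ≥0, LipschitzOnWith L v U

/-- The number `a` is the trace at `x` of the function `u` on `Ω`: the averages of `|u - a|` over
`B(x,r) ∩ Ω` tend to `0` as `r → 0⁺`. -/
def HasTraceAt (μ : Measure X) (Ω : Set X) (u : X → EReal) (x : X) (a : ℝ) : Prop :=
  Tendsto (fun r : ℝ => ⨍⁻ y in Metric.ball x r ∩ Ω, (u y - (a : EReal)).abs ∂μ)
    (𝓝[>] 0) (𝓝 0)

/-- The (nonempty, open) set `Ω` is a uniform domain with constant `cU ∈ (0,1]`: any two distinct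
points `x, y` of `Ω` are joined in `Ω` by an arc-length parametrized curve `γ` of length
`ℓ ≤ d(x,y) / cU` with `d(γ(t), X \ Ω) ≥ cU min {t, ℓ - t}`, where `d(x, ∅) = ∞`.
Connectedness of `Ω` is a consequence. -/
def IsUniformDomain {X : Type*} [MetricSpace X] (Ω : Set X) (cU : ℝ) : Prop :=
  0 < cU ∧ cU ≤ 1 ∧ ∀ x ∈ Ω, ∀ y ∈ Ω, x ≠ y → ∃ (γ : ℝ → X) (ℓ : ℝ),
    IsCurveIn Ω γ ℓ ∧ γ 0 = x ∧ γ ℓ = y ∧ ℓ ≤ cU⁻¹ * dist x y ∧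
    ∀ t ∈ Icc 0 ℓ, ENNReal.ofReal (cU * min t (ℓ - t)) ≤ Metric.infEDist (γ t) Ωᶜ

end MetricTrace

open MetricTrace

/-! The function `v` is a smoothing of `u` at the Whitney scale: `v(x)` is the mean of `u` against a
tent function centred at `x` with radius `ρ(x) = d(x, X \ Ω) / K`, where `K = 100 λ`. A tent is
Lipschitz in its centre and its radius, and `ρ` is Lipschitz, so `v(x) - v(y)` for nearby points is
at most `d(x,y) / ρ(x)` times the mean deviation of `u` from a constant on a slightly larger ball
(`IsDoubling.abs_tentMean_sub_tentMean_le`). The Poincaré inequality turns this into `d(x,y)` times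
a mean of an upper gradient `G` (`isWhitneyLipschitz_smoothing`). Thus near each ball of a Whitney
cover `v` is Lipschitz, with a constant `L a` comparable to the mean of `G` over a dilated ball.

The sum of the `L a` over the Whitney balls is then a Hajłasz gradient at the Whitney scale. In a
uniform domain, integrating along a uniform curve gives a full Hajłasz gradient, once the balls are
dilated enough for the ball of each point of the curve to reach the nearer end point. Doubling and
bounded overlap bound the integrals of both gradients by that of `G`
(`IsWhitneyCover.lintegral_smoothingGradient_le`).

The trace survives because the Whitney balls shrink towards the boundary: near a boundary point, the
deviation of `v` from a constant on a ball is controlled by that of `u` on the double ball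
(`IsWhitneyCover.hasTraceAt_smoothing`). The same estimate on the whole of `Ω` gives the `L¹` bound.
-/

namespace MetricTrace

/-! ### Consequences of the doubling condition -/

section Doubling

variable {X : Type*} [MetricSpace X] [MeasurableSpace X] {μ : Measure X} {Cd : ℝ≥0}

lemma IsDoubling.measure_ball_pos (hd : IsDoubling μ Cd) (x : X) {r : ℝ} (hr : 0 < r) :
    0 < μ (Metric.ball x r) := by
  have h := (hd x (r / 2) (by positivity)).1
  rwa [mul_div_cancel₀ r (two_ne_zero)] at h

lemma IsDoubling.measure_ball_lt_top (hd : IsDoubling μ Cd) (x : X) (r : ℝ) :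
    μ (Metric.ball x r) < ∞ := by
  rcases lt_or_ge 0 r with hr | hr
  · exact (hd x r hr).2.2
  · simp [Metric.ball_eq_empty.2 hr]

lemma IsDoubling.one_le (hd : IsDoubling μ Cd) (x : X) : 1 ≤ Cd := by
  by_contra! h
  have h1 := hd x 1 one_pos
  have h2 : μ (Metric.ball x 1) ≤ μ (Metric.ball x (2 * 1)) :=
    measure_mono (Metric.ball_subset_ball (by norm_num))
  have h3 : (Cd : ℝ≥0∞) * μ (Metric.ball x 1) < 1 * μ (Metric.ball x 1) :=
    ENNReal.mul_lt_mul_left (hd.measure_ball_pos x one_pos).ne' h1.2.2.ne (by exact_mod_cast h)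
  rw [one_mul] at h3
  exact absurd (h2.trans h1.2.1) (not_le.2 h3)

lemma IsDoubling.measure_ball_two_pow_le (hd : IsDoubling μ Cd) (x : X) {r : ℝ} (hr : 0 < r)
    (n : ℕ) : μ (Metric.ball x (2 ^ n * r)) ≤ (Cd : ℝ≥0∞) ^ n * μ (Metric.ball x r) := by
  induction n with
  | zero => simp
  | succ n ih =>
    calc μ (Metric.ball x (2 ^ (n + 1) * r)) = μ (Metric.ball x (2 * (2 ^ n * r))) := by
          congr 2; ring
      _ ≤ Cd * μ (Metric.ball x (2 ^ n * r)) := (hd x _ (by positivity)).2.1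
      _ ≤ Cd * ((Cd : ℝ≥0∞) ^ n * μ (Metric.ball x r)) := by gcongr
      _ = _ := by ring

/-- Comparison of the measures of two balls under the doubling condition. -/
lemma IsDoubling.measure_ball_le (hd : IsDoubling μ Cd) {x y : X} {r R : ℝ} (hr : 0 < r)
    (n : ℕ) (h : dist x y + R ≤ 2 ^ n * r) :
    μ (Metric.ball x R) ≤ (Cd : ℝ≥0∞) ^ n * μ (Metric.ball y r) :=
  (measure_mono (Metric.ball_subset_ball' (by linarith))).trans
    (hd.measure_ball_two_pow_le y hr n)

lemma IsDoubling.measureReal_ball_le (hd : IsDoubling μ Cd) {x y : X} {r R : ℝ} (hr : 0 < r)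
    (n : ℕ) (h : dist x y + R ≤ 2 ^ n * r) :
    μ.real (Metric.ball x R) ≤ (Cd : ℝ) ^ n * μ.real (Metric.ball y r) := by
  have h1 := ENNReal.toReal_mono (ENNReal.mul_ne_top (by simp)
    (hd.measure_ball_lt_top y r).ne) (hd.measure_ball_le hr n h)
  simpa [Measure.real] using h1

lemma IsDoubling.measureReal_ball_pos (hd : IsDoubling μ Cd) (x : X) {r : ℝ} (hr : 0 < r) :
    0 < μ.real (Metric.ball x r) :=
  ENNReal.toReal_pos (hd.measure_ball_pos x hr).ne' (hd.measure_ball_lt_top x r).ne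

lemma IsDoubling.sigmaFinite (hd : IsDoubling μ Cd) : SigmaFinite μ := by
  rcases isEmpty_or_nonempty X with h | ⟨⟨x⟩⟩
  · rw [Measure.eq_zero_of_isEmpty μ]; infer_instance
  · refine ⟨⟨⟨fun n : ℕ => Metric.ball x n, fun _ => trivial,
      fun n => hd.measure_ball_lt_top x n, Metric.iUnion_ball_nat x⟩⟩⟩

end Doubling

/-! ### Whitney covers with bounded overlap -/

section Whitney

variable {X : Type*} [MetricSpace X] {Ω : Set X} {K : ℝ}

/-- The radius `d(x, X \ Ω) / K` of the Whitney ball centred at `x`. -/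
noncomputable def whitneyRadius (Ω : Set X) (K : ℝ) (x : X) : ℝ := Metric.infDist x Ωᶜ / K

lemma whitneyRadius_pos (hΩ : IsOpen Ω) (hc : Ωᶜ.Nonempty) (hK : 0 < K) {x : X} (hx : x ∈ Ω) :
    0 < whitneyRadius Ω K x :=
  div_pos ((hΩ.isClosed_compl.notMem_iff_infDist_pos hc).1 (by simpa using hx)) hK

lemma mul_whitneyRadius (hK : 0 < K) (x : X) : K * whitneyRadius Ω K x = Metric.infDist x Ωᶜ :=
  mul_div_cancel₀ _ hK.ne'

lemma abs_whitneyRadius_sub_le (hK : 0 < K) (x y : X) :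
    K * |whitneyRadius Ω K x - whitneyRadius Ω K y| ≤ dist x y := by
  rw [← abs_of_pos hK, ← abs_mul, abs_of_pos hK, mul_sub, mul_whitneyRadius hK,
    mul_whitneyRadius hK]
  have h1 := Metric.infDist_le_infDist_add_dist (s := Ωᶜ) (x := x) (y := y)
  have h2 := Metric.infDist_le_infDist_add_dist (s := Ωᶜ) (x := y) (y := x)
  rw [dist_comm y x] at h2
  exact abs_le.2 ⟨by linarith, by linarith⟩

lemma whitneyRadius_le_add (hK : 100 ≤ K) (x y : X) :
    whitneyRadius Ω K x ≤ whitneyRadius Ω K y + dist x y / 100 := by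
  have h := abs_whitneyRadius_sub_le (Ω := Ω) (K := K) (by linarith) x y
  have h2 : 100 * |whitneyRadius Ω K x - whitneyRadius Ω K y| ≤ dist x y :=
    le_trans (by gcongr) h
  have := le_abs_self (whitneyRadius Ω K x - whitneyRadius Ω K y)
  linarith

lemma closedBall_subset_of_lt_infDist {x : X} {r : ℝ} (h : r < Metric.infDist x Ωᶜ) :
    Metric.closedBall x r ⊆ Ω := by
  intro y hy
  by_contra hy'
  have := Metric.infDist_le_dist_of_mem (x := x) (show y ∈ Ωᶜ from hy')
  rw [Metric.mem_closedBall, dist_comm] at hy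
  linarith

/-- A maximal separated subset of `Ω` at the Whitney scale. -/
lemma exists_whitney_separated (hΩ : IsOpen Ω) (hc : Ωᶜ.Nonempty) (hK : 100 ≤ K) :
    ∃ A ⊆ Ω, Ω ⊆ ⋃ a ∈ A, Metric.ball a (whitneyRadius Ω K a) ∧
      A.PairwiseDisjoint fun a => Metric.ball a (whitneyRadius Ω K a / 4) := by
  set ρ := whitneyRadius Ω K
  -- The relation gives `ρ a / 4 + ρ b / 4 ≤ dist a b`, hence disjoint quarter balls. A point
  -- outside all the balls is related to every centre, because `ρ` varies slowly, so maximality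
  -- yields the cover.
  let P : X → X → Prop := fun a b => ρ a ≤ 2 * dist a b ∧ ρ b ≤ 2 * dist a b
  obtain ⟨A, hA⟩ := zorn_subset {S : Set X | S ⊆ Ω ∧ S.Pairwise P} (by
    intro c hcS hchain
    refine ⟨⋃₀ c, ⟨sUnion_subset fun s hs => (hcS hs).1, ?_⟩, fun s hs => subset_sUnion_of_mem hs⟩
    exact (pairwise_sUnion hchain.directedOn).2 fun s hs => (hcS hs).2)
  refine ⟨A, hA.prop.1, fun x hx => ?_, fun a ha b hb hab => ?_⟩
  · have hρx : 0 < ρ x := whitneyRadius_pos hΩ hc (by linarith) hx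
    by_contra hcon
    simp only [mem_iUnion, Metric.mem_ball, not_exists, not_lt] at hcon
    have hins : insert x A ∈ {S : Set X | S ⊆ Ω ∧ S.Pairwise P} := by
      refine ⟨insert_subset hx hA.prop.1, hA.prop.2.insert fun b hb _ => ?_⟩
      have h1 := hcon b hb
      have h2 : ρ x ≤ ρ b + dist x b / 100 := whitneyRadius_le_add hK x b
      have h3 : (0 : ℝ) ≤ dist x b := dist_nonneg
      simp only [P, dist_comm b x]
      exact ⟨⟨by linarith, by linarith⟩, by linarith, by linarith⟩
    have hxA : x ∈ A := hA.le_of_ge hins (subset_insert x A) (mem_insert x A)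
    have := hcon x hxA
    rw [dist_self] at this
    linarith
  · have h := hA.prop.2 ha hb hab
    exact Metric.ball_disjoint_ball (by linarith [h.1, h.2, dist_nonneg (x := a) (y := b)])

variable [MeasurableSpace X] [BorelSpace X] {μ : Measure X} {Cd : ℝ≥0}

/-- A countable family `A` of centres of Whitney balls: the balls cover `Ω`, and their dilations
have bounded overlap. -/
structure IsWhitneyCover (μ : Measure X) (Ω : Set X) (K : ℝ) (N : ℝ≥0∞) (A : Set X) : Prop where
  countable : A.Countable
  subset : A ⊆ Ω
  cover : Ω ⊆ ⋃ a ∈ A, Metric.ball a (whitneyRadius Ω K a)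
  overlap : Measure.sum (fun a : A => μ.restrict (Metric.ball a (K / 20 * whitneyRadius Ω K a)))
    ≤ N • μ.restrict Ω

/-- Volume counting: if the dilated ball of `a` contains `x`, then the distances of `a` and `x` to
the complement are comparable, so the quarter ball of `a` lies in `B(x, D/10)` and has at least
`Cd⁻ⁿ` of its measure. The quarter balls are disjoint, so there are at most `Cdⁿ` of them. No
dilated ball reaches outside `Ω`. -/
lemma tsum_indicator_ball_le (hd : IsDoubling μ Cd) (hΩ : IsOpen Ω) (hc : Ωᶜ.Nonempty)
    (hK : 100 ≤ K) {n : ℕ} (hn : K ≤ 2 ^ n) {A : Set X} (hA : A ⊆ Ω) (hAc : A.Countable)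
    (hdisj : A.PairwiseDisjoint fun a => Metric.ball a (whitneyRadius Ω K a / 4)) (x : X) :
    ∑' a : A, (Metric.ball (a : X) (K / 20 * whitneyRadius Ω K a)).indicator
      (fun _ => (1 : ℝ≥0∞)) x ≤ Ω.indicator (fun _ => (Cd : ℝ≥0∞) ^ n) x := by
  have hK0 : 0 < K := by linarith
  have hdist : ∀ a : A, x ∈ Metric.ball (a : X) (K / 20 * whitneyRadius Ω K a) →
      dist x a < Metric.infDist (a : X) Ωᶜ / 20 := fun a hxa => by
    rw [← mul_whitneyRadius hK0]
    rw [Metric.mem_ball] at hxa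
    linarith
  by_cases hx : x ∈ Ω
  swap
  · have : ∀ a : A, (Metric.ball (a : X) (K / 20 * whitneyRadius Ω K a)).indicator
        (fun _ => (1 : ℝ≥0∞)) x = 0 := fun a => by
      refine indicator_of_notMem (fun hxa => hx ?_) _
      have h := hdist a hxa
      have h0 := Metric.infDist_nonneg (x := (a : X)) (s := Ωᶜ)
      have hpos := whitneyRadius_pos hΩ hc hK0 (hA a.2)
      rw [← mul_whitneyRadius hK0] at h
      refine closedBall_subset_of_lt_infDist (x := (a : X))
        (r := Metric.infDist (a : X) Ωᶜ / 20) ?_ ?_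
      · rw [← mul_whitneyRadius hK0]; nlinarith
      · rw [← mul_whitneyRadius hK0]; exact h.le
    simp [this]
  rw [indicator_of_mem hx]
  set D := Metric.infDist x Ωᶜ
  have hD : 0 < D := (hΩ.isClosed_compl.notMem_iff_infDist_pos hc).1 (by simpa using hx)
  have hpos := hd.measure_ball_pos x (show 0 < D / 10 by positivity)
  have hfin := hd.measure_ball_lt_top x (D / 10)
  have : Countable A := hAc.to_subtype
  have key : ∀ a : A, (Metric.ball (a : X) (K / 20 * whitneyRadius Ω K a)).indicator
      (fun _ => (1 : ℝ≥0∞)) x * μ (Metric.ball x (D / 10)) ≤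
      (Cd : ℝ≥0∞) ^ n *
        μ (Metric.ball (a : X) (whitneyRadius Ω K a / 4) ∩ Metric.ball x (D / 10)) := by
    intro a
    by_cases hxa : x ∈ Metric.ball (a : X) (K / 20 * whitneyRadius Ω K a)
    swap
    · simp [hxa]
    rw [indicator_of_mem hxa, one_mul]
    have h1 := hdist a hxa
    have h2 : Metric.infDist (a : X) Ωᶜ ≤ D + dist (a : X) x :=
      Metric.infDist_le_infDist_add_dist
    have h3 : D ≤ Metric.infDist (a : X) Ωᶜ + dist x a := Metric.infDist_le_infDist_add_dist
    rw [dist_comm] at h2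
    have hρ := whitneyRadius_pos hΩ hc hK0 (hA a.2)
    have h4 := mul_whitneyRadius (Ω := Ω) hK0 (a : X)
    have h5 : 100 * whitneyRadius Ω K a ≤ K * whitneyRadius Ω K a := by gcongr
    have h6 : K * whitneyRadius Ω K a ≤ 2 ^ n * whitneyRadius Ω K a := by gcongr
    rw [inter_eq_left.2 (Metric.ball_subset_ball' (by rw [dist_comm]; linarith))]
    exact hd.measure_ball_le (by positivity) n (by linarith)
  have hsum : (∑' a : A, (Metric.ball (a : X) (K / 20 * whitneyRadius Ω K a)).indicator
      (fun _ => (1 : ℝ≥0∞)) x) * μ (Metric.ball x (D / 10)) ≤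
      (Cd : ℝ≥0∞) ^ n * μ (Metric.ball x (D / 10)) := by
    rw [← ENNReal.tsum_mul_right]
    refine (ENNReal.tsum_le_tsum key).trans ?_
    rw [ENNReal.tsum_mul_left]
    gcongr
    refine (tsum_meas_le_meas_iUnion_of_disjoint μ
      (fun a => Metric.isOpen_ball.measurableSet.inter Metric.isOpen_ball.measurableSet) ?_).trans
      (measure_mono (iUnion_subset fun a => inter_subset_right))
    intro a b hab
    exact (hdisj a.2 b.2 (fun h => hab (Subtype.ext h))).mono inter_subset_left inter_subset_left
  exact (ENNReal.mul_le_mul_iff_left hpos.ne' hfin.ne).1 hsum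

lemma exists_isWhitneyCover (hd : IsDoubling μ Cd) (hΩ : IsOpen Ω) (hc : Ωᶜ.Nonempty)
    (hK : 100 ≤ K) {n : ℕ} (hn : K ≤ 2 ^ n) :
    ∃ A, IsWhitneyCover μ Ω K ((Cd : ℝ≥0∞) ^ n) A := by
  obtain ⟨A, hAΩ, hcov, hdisj⟩ := exists_whitney_separated hΩ hc hK
  have hK0 : 0 < K := by linarith
  -- The quarter balls are disjoint and of positive measure, and a σ-finite measure admits only
  -- countably many such sets.
  have hcount : A.Countable := by
    have := hd.sigmaFinite
    have h := Measure.countable_meas_pos_of_disjoint_iUnion (μ := μ)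
      (As := fun a : A => Metric.ball (a : X) (whitneyRadius Ω K a / 4))
      (fun a => Metric.isOpen_ball.measurableSet)
      (fun a b hab => hdisj a.2 b.2 (fun h => hab (Subtype.ext h)))
    have huniv : {a : A | 0 < μ (Metric.ball (a : X) (whitneyRadius Ω K a / 4))} = univ :=
      eq_univ_of_forall fun a => hd.measure_ball_pos _
        (by have := whitneyRadius_pos hΩ hc hK0 (hAΩ a.2); positivity)
    rw [huniv] at h
    exact (countable_coe_iff.1 (countable_univ_iff.1 h))
  refine ⟨A, hcount, hAΩ, hcov, ?_⟩
  have : Countable A := hcount.to_subtype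
  refine Measure.le_iff.2 fun S hS => ?_
  rw [Measure.sum_apply _ hS, Measure.smul_apply, smul_eq_mul]
  calc ∑' a : A, μ.restrict (Metric.ball (a : X) (K / 20 * whitneyRadius Ω K a)) S
      = ∑' a : A, ∫⁻ x in S, (Metric.ball (a : X) (K / 20 * whitneyRadius Ω K a)).indicator
          (fun _ => (1 : ℝ≥0∞)) x ∂μ := by
        refine tsum_congr fun a => ?_
        rw [lintegral_indicator_const Metric.isOpen_ball.measurableSet, one_mul,
          Measure.restrict_apply hS, Measure.restrict_apply Metric.isOpen_ball.measurableSet,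
          inter_comm]
    _ = ∫⁻ x in S, ∑' a : A, (Metric.ball (a : X) (K / 20 * whitneyRadius Ω K a)).indicator
          (fun _ => (1 : ℝ≥0∞)) x ∂μ :=
        (lintegral_tsum fun a =>
          (measurable_const.indicator Metric.isOpen_ball.measurableSet).aemeasurable).symm
    _ ≤ ∫⁻ x in S, Ω.indicator (fun _ => (Cd : ℝ≥0∞) ^ n) x ∂μ :=
        lintegral_mono fun x => tsum_indicator_ball_le hd hΩ hc hK hn hAΩ hcount hdisj x
    _ = (Cd : ℝ≥0∞) ^ n * μ.restrict Ω S := by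
        rw [lintegral_indicator_const hΩ.measurableSet, Measure.restrict_apply hΩ.measurableSet,
          Measure.restrict_apply hS, inter_comm]

omit [BorelSpace X] in
/-- Bounded overlap in integral form. -/
lemma IsWhitneyCover.tsum_lintegral_le {N : ℝ≥0∞} {A : Set X} (hA : IsWhitneyCover μ Ω K N A)
    (f : X → ℝ≥0∞) :
    ∑' a : A, ∫⁻ y in Metric.ball (a : X) (K / 20 * whitneyRadius Ω K a), f y ∂μ
      ≤ N * ∫⁻ y in Ω, f y ∂μ := by
  rw [← lintegral_sum_measure, ← smul_eq_mul, ← lintegral_smul_measure]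
  exact lintegral_mono' hA.overlap le_rfl

omit [BorelSpace X] in
lemma IsWhitneyCover.exists_mem_ball {N : ℝ≥0∞} {A : Set X} (hA : IsWhitneyCover μ Ω K N A)
    {x : X} (hx : x ∈ Ω) : ∃ a : A, x ∈ Metric.ball (a : X) (whitneyRadius Ω K a) := by
  obtain ⟨a, ha, hxa⟩ := mem_iUnion₂.1 (hA.cover hx)
  exact ⟨⟨a, ha⟩, hxa⟩

end Whitney

/-! ### Tent means and their oscillation -/

section TentMean

variable {X : Type*} [MetricSpace X]

/-- The tent function of height and radius `r` centred at `x`. -/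
noncomputable def tent (r : ℝ) (x y : X) : ℝ := max (r - dist x y) 0

lemma continuous_tent (r : ℝ) (x : X) : Continuous (tent r x) := by
  unfold tent; fun_prop

lemma tent_nonneg (r : ℝ) (x y : X) : 0 ≤ tent r x y := le_max_right _ _

lemma abs_tent_le {r : ℝ} (hr : 0 ≤ r) (x y : X) : |tent r x y| ≤ r := by
  rw [abs_of_nonneg (tent_nonneg r x y)]
  exact max_le (by linarith [dist_nonneg (x := x) (y := y)]) hr

lemma tent_eq_zero {r : ℝ} {x y : X} (h : y ∉ Metric.ball x r) : tent r x y = 0 := by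
  rw [Metric.mem_ball, dist_comm, not_lt] at h
  exact max_eq_right (by linarith)

lemma half_le_tent {r : ℝ} {x y : X} (h : y ∈ Metric.ball x (r / 2)) : r / 2 ≤ tent r x y := by
  rw [Metric.mem_ball, dist_comm] at h
  exact le_max_of_le_left (by linarith)

lemma abs_tent_sub_tent_le (r r' : ℝ) (x x' y : X) :
    |tent r x y - tent r' x' y| ≤ |r - r'| + dist x x' := by
  refine (abs_max_sub_max_le_abs _ _ _).trans ?_
  have h : r - dist x y - (r' - dist x' y) = (r - r') - (dist x y - dist x' y) := by ring
  rw [h]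
  exact (abs_sub _ _).trans (by gcongr; exact abs_dist_sub_le x x' y)

variable [MeasurableSpace X] {μ : Measure X}

omit [MetricSpace X] in
lemma abs_integral_mul_le {φ f : X → ℝ} {c : ℝ} {B : Set X}
    (hφ : ∀ y, |φ y| ≤ c) (hφ0 : ∀ y, y ∉ B → φ y = 0) (hf : IntegrableOn f B μ) :
    |∫ y, φ y * f y ∂μ| ≤ c * ∫ y in B, |f y| ∂μ := by
  rw [← setIntegral_eq_integral_of_forall_compl_eq_zero (s := B)
    (fun y hy => by rw [hφ0 y hy, zero_mul]), ← integral_const_mul]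
  refine (norm_integral_le_integral_norm (μ := μ.restrict B) (fun y => φ y * f y)).trans ?_
  refine integral_mono_of_nonneg (Eventually.of_forall fun y => norm_nonneg _)
    (hf.abs.const_mul c) (Eventually.of_forall fun y => ?_)
  simp only [norm_mul, Real.norm_eq_abs]
  gcongr
  exact hφ y

variable [BorelSpace X]

lemma integrable_tent_mul {f : X → ℝ} {r : ℝ} (hr : 0 ≤ r) {x : X}
    (hf : IntegrableOn f (Metric.ball x r) μ) : Integrable (fun y => tent r x y * f y) μ := by
  refine (integrableOn_iff_integrable_of_support_subset (s := Metric.ball x r) ?_).1 ?_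
  · intro y hy
    by_contra h
    exact hy (by simp [tent_eq_zero h])
  · exact Integrable.bdd_mul (c := r) hf (continuous_tent r x).aestronglyMeasurable
      (Eventually.of_forall fun y => abs_tent_le hr x y)

/-- The mean value of `w` with respect to the tent function centred at `x`. -/
noncomputable def tentMean (μ : Measure X) (w : X → ℝ) (r : ℝ) (x : X) : ℝ :=
  (∫ y, tent r x y * w y ∂μ) / ∫ y, tent r x y ∂μ

variable {Cd : ℝ≥0}

lemma IsDoubling.integrable_tent (hd : IsDoubling μ Cd) {r : ℝ} (hr : 0 ≤ r) (x : X) :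
    Integrable (tent r x) μ := by
  have h := integrable_tent_mul (μ := μ) (f := fun _ => 1) hr
    (integrableOn_const (hd.measure_ball_lt_top x r).ne)
  simpa using h

lemma IsDoubling.le_integral_tent (hd : IsDoubling μ Cd) {r : ℝ} (hr : 0 ≤ r) (x : X) :
    r / 2 * μ.real (Metric.ball x (r / 2)) ≤ ∫ y, tent r x y ∂μ := by
  have h : ∫ y, (Metric.ball x (r / 2)).indicator (fun _ => r / 2) y ∂μ ≤
      ∫ y, tent r x y ∂μ := by
    refine integral_mono ?_ (hd.integrable_tent hr x) fun y => ?_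
    · exact (integrable_indicator_iff Metric.isOpen_ball.measurableSet).2
        (integrableOn_const (hd.measure_ball_lt_top x _).ne)
    · by_cases hy : y ∈ Metric.ball x (r / 2)
      · simpa [hy] using half_le_tent hy
      · simpa [hy] using tent_nonneg r x y
  rwa [integral_indicator_const _ Metric.isOpen_ball.measurableSet, smul_eq_mul, mul_comm] at h

lemma IsDoubling.integral_tent_pos (hd : IsDoubling μ Cd) {r : ℝ} (hr : 0 < r) (x : X) :
    0 < ∫ y, tent r x y ∂μ :=
  (mul_pos (by positivity) (hd.measureReal_ball_pos x (by positivity))).trans_le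
    (hd.le_integral_tent hr.le x)

lemma IsDoubling.tentMean_sub (hd : IsDoubling μ Cd) {w : X → ℝ} (hw : Integrable w μ) (m : ℝ)
    {r : ℝ} (hr : 0 < r) (x : X) :
    tentMean μ w r x - m = (∫ y, tent r x y * (w y - m) ∂μ) / ∫ y, tent r x y ∂μ := by
  have h : ∫ y, tent r x y * (w y - m) ∂μ =
      (∫ y, tent r x y * w y ∂μ) - (∫ y, tent r x y ∂μ) * m := by
    rw [← integral_mul_const, ← integral_sub (integrable_tent_mul hr.le hw.integrableOn)
      ((hd.integrable_tent hr.le x).mul_const m)]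
    simp only [mul_sub]
  rw [h, tentMean, sub_div, mul_div_cancel_left₀ _ (hd.integral_tent_pos hr x).ne']

omit [BorelSpace X] in
lemma IsDoubling.integrableOn_ball_sub (hd : IsDoubling μ Cd) {w : X → ℝ} (hw : Integrable w μ)
    (m : ℝ) (x : X) (r : ℝ) : IntegrableOn (fun y => w y - m) (Metric.ball x r) μ :=
  hw.integrableOn.sub (integrableOn_const (hd.measure_ball_lt_top x r).ne)

/-- The tent is at most `r`, vanishes off the ball, and is at least `r / 2` on the half ball. -/
lemma IsDoubling.abs_tentMean_sub_le (hd : IsDoubling μ Cd) {w : X → ℝ} (hw : Integrable w μ)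
    (m : ℝ) {r : ℝ} (hr : 0 < r) (x : X) :
    |tentMean μ w r x - m| ≤
      2 * (∫ y in Metric.ball x r, |w y - m| ∂μ) / μ.real (Metric.ball x (r / 2)) := by
  have hN := hd.le_integral_tent hr.le x
  have hb := hd.measureReal_ball_pos x (show 0 < r / 2 by positivity)
  have hJ : 0 ≤ ∫ y in Metric.ball x r, |w y - m| ∂μ := integral_nonneg fun y => abs_nonneg _
  rw [hd.tentMean_sub hw m hr x, abs_div, abs_of_pos (hd.integral_tent_pos hr x),
    div_le_div_iff₀ (hd.integral_tent_pos hr x) hb]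
  have h := abs_integral_mul_le (μ := μ) (abs_tent_le hr.le x) (fun y => tent_eq_zero)
    (hd.integrableOn_ball_sub hw m x r)
  calc |∫ y, tent r x y * (w y - m) ∂μ| * μ.real (Metric.ball x (r / 2))
      ≤ (r * ∫ y in Metric.ball x r, |w y - m| ∂μ) * μ.real (Metric.ball x (r / 2)) := by gcongr
    _ = 2 * (∫ y in Metric.ball x r, |w y - m| ∂μ) *
        (r / 2 * μ.real (Metric.ball x (r / 2))) := by ring
    _ ≤ _ := by gcongr

/-- The arithmetic of comparing two weighted means: `A`, `A'` are numerators, `N`, `N'` the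
integrals of the tents, `J` the integrated deviation, `b` the measure of a common ball and `c` the
doubling constant. The changes of numerator and of denominator are estimated separately. -/
lemma abs_div_sub_div_le {A A' N N' J b d r r' c : ℝ} (hN : 0 < N) (hN' : 0 < N') (hJ : 0 ≤ J)
    (hb : 0 < b) (hd : 0 ≤ d) (hr : 0 < r) (hr' : 0 ≤ r') (hc : 1 ≤ c)
    (hA : |A - A'| ≤ 2 * d * J) (hA' : |A'| ≤ r' * J) (hNN : |N - N'| ≤ 2 * d * b)
    (h : r * b ≤ 2 * c ^ 2 * N) (h' : r' * b ≤ 2 * c ^ 4 * N') :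
    |A / N - A' / N'| ≤ 12 * c ^ 6 * (d * J / (r * b)) := by
  have e : A / N - A' / N' = (A - A') / N + A' * (N' - N) / (N * N') := by
    field_simp; ring
  have h1 : N⁻¹ ≤ 2 * c ^ 2 / (r * b) := by
    rw [inv_eq_one_div, div_le_div_iff₀ hN (by positivity)]; linarith
  have h2 : |(A - A') / N| ≤ 2 * d * J * N⁻¹ := by
    rw [abs_div, abs_of_pos hN, div_eq_mul_inv]; gcongr
  have h3 : |A' * (N' - N) / (N * N')| ≤ 4 * c ^ 4 * (d * J) * N⁻¹ := by
    rw [abs_div, abs_mul, abs_of_pos (mul_pos hN hN'), abs_sub_comm N' N,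
      div_le_iff₀ (mul_pos hN hN')]
    calc |A'| * |N - N'| ≤ (r' * J) * (2 * d * b) := by gcongr
      _ = 2 * d * J * (r' * b) := by ring
      _ ≤ 2 * d * J * (2 * c ^ 4 * N') := by gcongr
      _ = _ := by field_simp; ring
  have h4 : c ^ 2 ≤ c ^ 6 := pow_le_pow_right₀ hc (by norm_num)
  rw [e]
  calc _ ≤ 2 * d * J * N⁻¹ + 4 * c ^ 4 * (d * J) * N⁻¹ := (abs_add_le _ _).trans (add_le_add h2 h3)
    _ = (2 + 4 * c ^ 4) * (d * J) * N⁻¹ := by ring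
    _ ≤ (2 + 4 * c ^ 4) * (d * J) * (2 * c ^ 2 / (r * b)) := by gcongr
    _ = (4 * c ^ 2 + 8 * c ^ 6) * (d * J / (r * b)) := by ring
    _ ≤ _ := by gcongr; linarith

/-- Oscillation of tent means at comparable scales. -/
lemma IsDoubling.abs_tentMean_sub_tentMean_le (hd : IsDoubling μ Cd) {w : X → ℝ}
    (hw : Integrable w μ) (m : ℝ) {r r' : ℝ} (hr : 0 < r) (hr' : 0 < r') {x x' : X}
    (hx : dist x x' ≤ r / 4) (hrr : |r - r'| ≤ dist x x') :
    |tentMean μ w r x - tentMean μ w r' x'| ≤ 12 * (Cd : ℝ) ^ 6 *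
      (dist x x' * (∫ y in Metric.ball x (2 * r), |w y - m| ∂μ) /
        (r * μ.real (Metric.ball x (2 * r)))) := by
  have hr1 := abs_le.1 hrr
  have hB : Metric.ball x r ⊆ Metric.ball x (2 * r) := Metric.ball_subset_ball (by linarith)
  have hB' : Metric.ball x' r' ⊆ Metric.ball x (2 * r) :=
    Metric.ball_subset_ball' (by rw [dist_comm]; linarith)
  have hint := hd.integrableOn_ball_sub hw m x (2 * r)
  have hdiff : ∀ y, |tent r x y - tent r' x' y| ≤ 2 * dist x x' := fun y =>
    (abs_tent_sub_tent_le r r' x x' y).trans (by linarith)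
  have hzero : ∀ y, y ∉ Metric.ball x (2 * r) → tent r x y - tent r' x' y = 0 := fun y hy => by
    rw [tent_eq_zero (fun h => hy (hB h)), tent_eq_zero (fun h => hy (hB' h)), sub_zero]
  -- Tent means reproduce constants, so `m` may be subtracted from `w` in both; only the deviation
  -- from `m` then enters.
  have e : tentMean μ w r x - tentMean μ w r' x' =
      (tentMean μ w r x - m) - (tentMean μ w r' x' - m) := by ring
  rw [e, hd.tentMean_sub hw m hr x, hd.tentMean_sub hw m hr' x']
  refine abs_div_sub_div_le (hd.integral_tent_pos hr x) (hd.integral_tent_pos hr' x')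
    (integral_nonneg fun y => abs_nonneg _) (hd.measureReal_ball_pos x (by positivity))
    dist_nonneg hr hr'.le (by exact_mod_cast hd.one_le x) ?_ ?_ ?_ ?_ ?_
  · rw [← integral_sub (integrable_tent_mul hr.le (hint.mono_set hB))
      (integrable_tent_mul hr'.le (hint.mono_set hB'))]
    simp only [← sub_mul]
    exact abs_integral_mul_le hdiff hzero hint
  · exact abs_integral_mul_le (abs_tent_le hr'.le x')
      (fun y hy => tent_eq_zero (fun h => hy (hB' h))) hint
  · rw [← integral_sub (hd.integrable_tent hr.le x) (hd.integrable_tent hr'.le x')]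
    have h := abs_integral_mul_le (μ := μ) (f := fun _ => 1) hdiff hzero
      (integrableOn_const (hd.measure_ball_lt_top x _).ne)
    simpa using h
  · have h1 := hd.measureReal_ball_le (x := x) (y := x) (r := r / 2) (R := 2 * r)
      (by positivity) 2 (by rw [dist_self]; linarith)
    have h2 := hd.le_integral_tent hr.le x
    calc r * μ.real (Metric.ball x (2 * r))
        ≤ r * ((Cd : ℝ) ^ 2 * μ.real (Metric.ball x (r / 2))) := by gcongr
      _ = 2 * (Cd : ℝ) ^ 2 * (r / 2 * μ.real (Metric.ball x (r / 2))) := by ring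
      _ ≤ _ := by gcongr
  · have h1 := hd.measureReal_ball_le (x := x) (y := x') (r := r' / 2) (R := 2 * r)
      (by positivity) 4 (by linarith)
    have h2 := hd.le_integral_tent hr'.le x'
    calc r' * μ.real (Metric.ball x (2 * r))
        ≤ r' * ((Cd : ℝ) ^ 4 * μ.real (Metric.ball x' (r' / 2))) := by gcongr
      _ = 2 * (Cd : ℝ) ^ 4 * (r' / 2 * μ.real (Metric.ball x' (r' / 2))) := by ring
      _ ≤ _ := by gcongr

end TentMean

/-! ### Upper gradients and the Poincaré inequality inside `Ω` -/

lemma HasUnitSpeedOn.lipschitzOnWith {E : Type*} [PseudoEMetricSpace E] {f : ℝ → E} {s : Set ℝ}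
    (h : HasUnitSpeedOn f s) : LipschitzOnWith 1 f s := by
  have key : ∀ x ∈ s, ∀ y ∈ s, x ≤ y → edist (f x) (f y) ≤ edist x y := fun x hx y hy hxy => by
    calc edist (f x) (f y) ≤ eVariationOn f (s ∩ Icc x y) :=
          eVariationOn.edist_le f ⟨hx, left_mem_Icc.2 hxy⟩ ⟨hy, right_mem_Icc.2 hxy⟩
      _ = ENNReal.ofReal (y - x) := by simpa using h hx hy
      _ = edist x y := by
        rw [edist_comm, edist_dist, Real.dist_eq, abs_of_nonneg (by linarith)]
  intro x hx y hy
  rw [ENNReal.coe_one, one_mul]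
  rcases le_total x y with hxy | hxy
  · exact key x hx y hy hxy
  · rw [edist_comm, edist_comm x y]; exact key y hy x hx hxy

/-- Where `u` is infinite the right side is `∞`, so passing to real values needs no prior proof that
`u` is finite almost everywhere. -/
lemma enorm_toReal_sub_le (u : EReal) (t : ℝ) : ‖u.toReal - t‖ₑ ≤ (u - (t : EReal)).abs := by
  induction u with
  | bot => simp
  | top => simp
  | coe a => rw [EReal.toReal_coe, ← EReal.coe_sub, EReal.abs_def, Real.enorm_eq_ofReal_abs]

section

variable {X : Type*} [MetricSpace X] [MeasurableSpace X] {μ : Measure X} {Ω : Set X}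
  {u : X → EReal}

omit [MeasurableSpace X] in
lemma lineIntegral_mono_on {g h : X → ℝ≥0∞} {γ : ℝ → X} {ℓ : ℝ} {A : Set X}
    (hγ : IsCurveIn A γ ℓ) (hgh : ∀ x ∈ A, g x ≤ h x) :
    lineIntegral g γ ℓ ≤ lineIntegral h γ ℓ :=
  setLIntegral_mono_ae' measurableSet_Icc
    (Eventually.of_forall fun _ ht => hgh _ (hγ.mapsTo ht))

/-- A `1`-weak upper gradient is dominated by a Borel upper gradient (along all curves in `Ω`)
with nearly the same integral. -/
lemma IsWeakUpperGradientOn.exists_measurable_ge {g : X → ℝ≥0∞}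
    (hg : IsWeakUpperGradientOn μ Ω u g) {δ : ℝ≥0∞} (hδ : δ ≠ 0) :
    ∃ G : X → ℝ≥0∞, Measurable G ∧
      (∀ (γ : ℝ → X) (ℓ : ℝ), IsCurveIn Ω γ ℓ → UpperGradientIneq u G γ ℓ) ∧
      ∫⁻ x in Ω, G x ∂μ ≤ (∫⁻ x in Ω, g x ∂μ) + δ := by
  obtain ⟨hgm, ρ, hρm, hρ, hΓ⟩ := hg
  obtain ⟨ε, hε0, hε⟩ : ∃ ε : ℝ≥0, 0 < ε ∧ ε * ∫⁻ x, ρ x ∂μ < δ :=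
    ENNReal.exists_nnreal_pos_mul_lt hρ.ne hδ
  set N := toMeasurable (μ.restrict Ω) {x | g x ≠ hgm.mk g x} with hN
  have hN0 : μ.restrict Ω N = 0 := by
    rw [hN, measure_toMeasurable]; exact hgm.ae_eq_mk
  have hNm : MeasurableSet N := measurableSet_toMeasurable _ _
  -- The value `∞` on the Borel null set `N` makes the sum dominate `g` everywhere on `Ω`, which
  -- settles the curves where the inequality for `g` holds. The term `ε ρ` has infinite integral
  -- along the exceptional curves and costs at most `δ`.
  refine ⟨fun x => hgm.mk g x + N.indicator (fun _ => ∞) x + ε * ρ x,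
    (hgm.measurable_mk.add (measurable_const.indicator hNm)).add (hρm.const_mul _), ?_, ?_⟩
  · intro γ ℓ hγ
    by_cases h : UpperGradientIneq u g γ ℓ
    · refine le_trans h (lineIntegral_mono_on hγ fun x _ => ?_)
      by_cases hx : x ∈ N
      · simp [hx]
      · have : g x = hgm.mk g x := by
          by_contra hne
          exact hx (subset_toMeasurable _ _ hne)
        rw [this, add_assoc]
        exact le_self_add
    · have h1 := hΓ (γ, ℓ) ⟨hγ, h⟩
      have h2 : lineIntegral (fun x => ε * ρ x) γ ℓ = ∞ := by
        rw [lineIntegral, lintegral_const_mul' _ _ ENNReal.coe_ne_top]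
        change ε * lineIntegral ρ γ ℓ = ∞
        rw [show lineIntegral ρ γ ℓ = ∞ from h1]
        exact ENNReal.mul_top (by exact_mod_cast hε0.ne')
      refine le_trans ?_ (lineIntegral_mono_on (g := fun x => ε * ρ x) hγ fun x _ => le_add_self)
      rw [h2]; exact le_top
  · rw [lintegral_add_right _ (hρm.const_mul _),
      lintegral_add_right _ (measurable_const.indicator hNm), lintegral_indicator_const hNm, hN0,
      mul_zero, add_zero, lintegral_congr_ae hgm.ae_eq_mk.symm]
    gcongr
    rw [lintegral_const_mul _ hρm]
    refine le_trans ?_ hε.le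
    gcongr
    exact Measure.restrict_le_self

omit [MeasurableSpace X] in
-- The complement of the closed ball is open, so a curve that leaves the closed ball stays outside
-- it for a parameter interval of positive length, on which `G` is `∞`.
lemma IsCurveIn.mapsTo_closedBall_or {γ : ℝ → X} {ℓ : ℝ} (hγ : IsCurveIn univ γ ℓ) (x : X)
    (R : ℝ) (G : X → ℝ≥0∞) (hG : ∀ y, y ∉ Metric.ball x R → G y = ∞) :
    MapsTo γ (Icc 0 ℓ) (Metric.closedBall x R) ∨ lineIntegral G γ ℓ = ∞ := by
  by_cases h : MapsTo γ (Icc 0 ℓ) (Metric.closedBall x R)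
  · exact Or.inl h
  right
  simp only [MapsTo, not_forall] at h
  obtain ⟨t, ht, hγt⟩ := h
  have hcont : ContinuousOn γ (Icc 0 ℓ) :=
    (HasUnitSpeedOn.lipschitzOnWith hγ.unit_speed).continuousOn
  have hnhds : γ ⁻¹' (Metric.closedBall x R)ᶜ ∈ 𝓝[Icc 0 ℓ] t :=
    (hcont t ht).preimage_mem_nhdsWithin (Metric.isClosed_closedBall.isOpen_compl.mem_nhds hγt)
  obtain ⟨ε, hε, hsub⟩ := Metric.mem_nhdsWithin_iff.1 hnhds
  set a := max 0 (t - ε)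
  set b := min ℓ (t + ε)
  have hab : a < b := by
    have := hγ.length_pos
    simp only [a, b, max_lt_iff, lt_min_iff]
    exact ⟨⟨this, by linarith [ht.2]⟩, by linarith [ht.1], by linarith⟩
  have hIoo : Ioo a b ⊆ Icc 0 ℓ := fun s hs =>
    ⟨((le_max_left _ _).trans_lt hs.1).le, (hs.2.trans_le (min_le_left _ _)).le⟩
  have hval : ∀ s ∈ Ioo a b, G (γ s) = ∞ := fun s hs => by
    refine hG _ fun hmem => ?_
    have : s ∈ Metric.ball t ε := by
      rw [Metric.mem_ball, Real.dist_eq, abs_lt]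
      have h1 := (le_max_right 0 (t - ε)).trans_lt hs.1
      have h2 := hs.2.trans_le (min_le_right ℓ (t + ε))
      exact ⟨by linarith, by linarith⟩
    exact hsub ⟨this, hIoo hs⟩ (Metric.ball_subset_closedBall hmem)
  rw [eq_top_iff]
  calc (∞ : ℝ≥0∞) = ∫⁻ s in Ioo a b, ∞ := by
        rw [setLIntegral_const, Real.volume_Ioo, ENNReal.top_mul]
        simpa using hab
    _ = ∫⁻ s in Ioo a b, G (γ s) :=
        (setLIntegral_congr_fun measurableSet_Ioo fun s hs => hval s hs).symm
    _ ≤ lineIntegral G γ ℓ := lintegral_mono_set hIoo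

variable [BorelSpace X]

/-- The Poincaré inequality for functions defined in `Ω`, on balls well inside `Ω`. -/
lemma SupportsPoincare.exists_lintegral_le {CP : ℝ≥0} {lam : ℝ} {Cd : ℝ≥0}
    (hP : SupportsPoincare μ CP lam) (hlam : 1 ≤ lam) (hd : IsDoubling μ Cd) (hΩ : IsOpen Ω)
    (hum : AEMeasurable u (μ.restrict Ω)) (hu : ∫⁻ x in Ω, (u x).abs ∂μ < ∞) {G : X → ℝ≥0∞}
    (hGm : Measurable G)
    (hG : ∀ (γ : ℝ → X) (ℓ : ℝ), IsCurveIn Ω γ ℓ → UpperGradientIneq u G γ ℓ)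
    {x : X} {r : ℝ} (hr : 0 < r) (hB : Metric.closedBall x (lam * r) ⊆ Ω) :
    ∃ m : ℝ, ∫⁻ y in Metric.ball x r, (u y - (m : EReal)).abs ∂μ ≤
      CP * ENNReal.ofReal r * ∫⁻ y in Metric.ball x (lam * r), G y ∂μ := by
  classical
  set u' : X → EReal := Ω.indicator u
  -- The Poincaré inequality is assumed only for functions on all of `X`. Setting `G' = ∞` off the
  -- ball makes the zero extension of `u` admissible: a curve either stays in the closed ball, hence
  -- in `Ω`, or has infinite integral. On the ball itself `G' = G`.
  set G' : X → ℝ≥0∞ := (Metric.ball x (lam * r)).piecewise G (fun _ => ∞)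
  have hrl : r ≤ lam * r := le_mul_of_one_le_left hr.le hlam
  have hu'Ω : ∀ y ∈ Ω, u' y = u y := fun y hy => indicator_of_mem hy _
  have hloc : MemL1Loc μ u' := fun U _ _ => by
    refine ⟨((aemeasurable_indicator_iff hΩ.measurableSet).2 hum).restrict, ?_⟩
    refine lt_of_le_of_lt ?_ hu
    calc ∫⁻ y in U, (u' y).abs ∂μ ≤ ∫⁻ y, (u' y).abs ∂μ :=
          lintegral_mono' Measure.restrict_le_self le_rfl
      _ = ∫⁻ y, Ω.indicator (fun y => (u y).abs) y ∂μ := by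
          refine lintegral_congr fun y => ?_
          by_cases hy : y ∈ Ω <;> simp [u', hy]
      _ = _ := lintegral_indicator hΩ.measurableSet _
  have hUG : IsUpperGradient u' G' := by
    refine ⟨hGm.piecewise Metric.isOpen_ball.measurableSet measurable_const, fun γ ℓ hγ => ?_⟩
    rcases hγ.mapsTo_closedBall_or x (lam * r) G' (fun y hy => piecewise_eq_of_notMem _ _ _ hy)
      with h | h
    · have hγΩ : IsCurveIn Ω γ ℓ := ⟨hγ.length_pos, hγ.unit_speed, h.mono_right hB⟩
      have h0 := hγΩ.mapsTo (left_mem_Icc.2 hγ.length_pos.le)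
      have hℓ := hγΩ.mapsTo (right_mem_Icc.2 hγ.length_pos.le)
      have h1 := hG γ ℓ hγΩ
      unfold UpperGradientIneq at h1 ⊢
      rw [hu'Ω _ h0, hu'Ω _ hℓ]
      refine h1.trans (lineIntegral_mono_on hγΩ fun y _ => ?_)
      by_cases hy : y ∈ Metric.ball x (lam * r)
      · simp only [G', piecewise_eq_of_mem _ _ _ hy]; exact le_rfl
      · simp only [G', piecewise_eq_of_notMem _ _ _ hy]; exact le_top
    · unfold UpperGradientIneq
      rw [h]; exact le_top
  refine ⟨⨍ z in Metric.ball x r, (u' z).toReal ∂μ, ?_⟩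
  have h := hP x r hr u' G' hloc hUG
  set m := ⨍ z in Metric.ball x r, (u' z).toReal ∂μ
  have hpos := hd.measure_ball_pos x hr
  have hfin := hd.measure_ball_lt_top x r
  have e1 : ∫⁻ y in Metric.ball x r, (u' y - (m : EReal)).abs ∂μ =
      ∫⁻ y in Metric.ball x r, (u y - (m : EReal)).abs ∂μ :=
    setLIntegral_congr_fun Metric.isOpen_ball.measurableSet fun y hy => by
      rw [hu'Ω y (hB (Metric.ball_subset_closedBall (Metric.ball_subset_ball hrl hy)))]
  have e2 : ∫⁻ y in Metric.ball x (lam * r), G' y ∂μ =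
      ∫⁻ y in Metric.ball x (lam * r), G y ∂μ :=
    setLIntegral_congr_fun Metric.isOpen_ball.measurableSet fun y hy =>
      piecewise_eq_of_mem _ _ _ hy
  rw [setLAverage_eq, setLAverage_eq, e1, e2, ENNReal.div_le_iff hpos.ne' hfin.ne] at h
  refine h.trans ?_
  rw [mul_assoc _ _ (μ _)]
  gcongr
  -- The mean on the right can be normalised by the smaller measure of `B(x,r)`, since `r ≤ λ r`;
  -- the normalisations then cancel.
  calc _ ≤ (∫⁻ y in Metric.ball x (lam * r), G y ∂μ) / μ (Metric.ball x r) *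
        μ (Metric.ball x r) := by
        gcongr
    _ ≤ _ := (ENNReal.div_mul_cancel hpos.ne' hfin.ne).le

end

/-! ### From Lipschitz constants on Whitney balls to Hajłasz gradients -/

/-- Continuous induction: the set of `t` at which the bound from `a` to `t` holds is closed and
extends to the right of each of its points. The radii `ε` need not be bounded below. -/
lemma abs_sub_le_of_locally {f : ℝ → ℝ} {a b L : ℝ} (hab : a ≤ b)
    (h : ∀ t ∈ Icc a b, ∃ ε > 0, ∀ s ∈ Icc a b, |s - t| ≤ ε → |f t - f s| ≤ L * |s - t|) :
    |f b - f a| ≤ L * (b - a) := by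
  have hcont : ContinuousOn f (Icc a b) := by
    intro t ht
    obtain ⟨ε, hε, hs⟩ := h t ht
    refine tendsto_iff_dist_tendsto_zero.2 (squeeze_zero' (g := fun s => L * |s - t|)
      (Eventually.of_forall fun s => dist_nonneg) ?_ ?_)
    · filter_upwards [self_mem_nhdsWithin,
        mem_nhdsWithin_of_mem_nhds (Metric.ball_mem_nhds t hε)] with s hsI hsb
      rw [dist_comm, Real.dist_eq]
      exact hs s hsI (by rw [← Real.dist_eq]; exact (Metric.mem_ball.1 hsb).le)
    · have : Continuous fun s : ℝ => L * |s - t| := by fun_prop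
      simpa using (this.tendsto t).mono_left nhdsWithin_le_nhds
  set S : Set ℝ := {t | |f t - f a| ≤ L * (t - a)}
  have hclosed : IsClosed (S ∩ Icc a b) := by
    have : S ∩ Icc a b = {t ∈ Icc a b | |f t - f a| ≤ L * (t - a)} := by
      ext t; exact and_comm
    rw [this]
    exact isClosed_Icc.isClosed_le (by fun_prop) (by fun_prop)
  have hS : Icc a b ⊆ S := hclosed.Icc_subset_of_forall_exists_gt (by simp [S]) (by
    rintro t ⟨htS, ht⟩ y hy
    obtain ⟨ε, hε, hs⟩ := h t (Ico_subset_Icc_self ht)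
    set s := min (min y b) (t + ε)
    have hts : t < s := lt_min (lt_min hy ht.2) (by linarith)
    have hsb : s ≤ b := (min_le_left _ _).trans (min_le_right _ _)
    have hsε : s ≤ t + ε := min_le_right _ _
    have e : |s - t| = s - t := abs_of_pos (by linarith)
    have h1 := hs s ⟨by linarith [ht.1], hsb⟩ (by rw [e]; linarith)
    rw [e, abs_sub_comm] at h1
    refine ⟨s, ?_, hts, (min_le_left _ _).trans (min_le_left _ _)⟩
    have h2 := abs_sub_le (f s) (f t) (f a)
    have h3 : |f t - f a| ≤ L * (t - a) := htS
    change |f s - f a| ≤ L * (s - a)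
    linarith)
  exact hS (right_mem_Icc.2 hab)

section

variable {X : Type*} [MetricSpace X] [MeasurableSpace X] {μ : Measure X} {Ω A : Set X} {K : ℝ}
  {N : ℝ≥0∞}

/-- `v` is Lipschitz with constant `L a` near every point of the Whitney ball centred at
`a ∈ A`. -/
def IsWhitneyLipschitz (Ω : Set X) (K : ℝ) (A : Set X) (v L : X → ℝ) : Prop :=
  ∀ a ∈ A, 0 ≤ L a ∧ ∀ x ∈ Metric.ball a (whitneyRadius Ω K a), ∀ y,
    dist x y ≤ whitneyRadius Ω K x / 4 → |v x - v y| ≤ L a * dist x y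

/-- The sum of the constants `L a` over the dilated Whitney balls. -/
noncomputable def whitneySum (Ω : Set X) (K : ℝ) (A : Set X) (L : X → ℝ) (τ : ℝ) (x : X) : ℝ≥0∞ :=
  ∑' a : A, (Metric.ball (a : X) (τ * whitneyRadius Ω K a)).indicator
    (fun _ => ENNReal.ofReal (L a)) x

omit [MeasurableSpace X] in
lemma le_whitneySum {L : X → ℝ} {τ : ℝ} {x : X} {a : A}
    (hx : x ∈ Metric.ball (a : X) (τ * whitneyRadius Ω K a)) :
    ENNReal.ofReal (L a) ≤ whitneySum Ω K A L τ x := by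
  refine le_trans ?_ (ENNReal.le_tsum a)
  rw [indicator_of_mem hx]

omit [MeasurableSpace X] in
lemma infEDist_compl_eq (hc : Ωᶜ.Nonempty) (hK : 0 < K) (x : X) :
    Metric.infEDist x Ωᶜ = ENNReal.ofReal (K * whitneyRadius Ω K x) := by
  rw [mul_whitneyRadius hK, Metric.infDist, ENNReal.ofReal_toReal (Metric.infEDist_ne_top hc)]

lemma IsWhitneyLipschitz.locallyLipschitzOn (hΩ : IsOpen Ω) (hc : Ωᶜ.Nonempty) (hK : 100 ≤ K)
    (hA : IsWhitneyCover μ Ω K N A) {v L : X → ℝ} (hv : IsWhitneyLipschitz Ω K A v L) :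
    LocallyLipschitzOn Ω v := by
  intro x hx
  obtain ⟨a, hxa⟩ := hA.exists_mem_ball hx
  obtain ⟨hL, h⟩ := hv a a.2
  have hρ := whitneyRadius_pos hΩ hc (by linarith : 0 < K) hx
  refine ⟨⟨L a, hL⟩, Metric.ball a (whitneyRadius Ω K a) ∩
    Metric.ball x (whitneyRadius Ω K x / 16), mem_nhdsWithin_of_mem_nhds
    (inter_mem (Metric.isOpen_ball.mem_nhds hxa) (Metric.ball_mem_nhds x (by positivity))), ?_⟩
  refine LipschitzOnWith.of_dist_le_mul fun y hy z hz => h y hy.1 z ?_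
  have h1 := whitneyRadius_le_add (Ω := Ω) hK x y
  have h2 := Metric.mem_ball.1 hy.2
  have h3 := Metric.mem_ball.1 hz.2
  have h4 := dist_triangle_right y z x
  rw [dist_comm] at h1
  linarith

omit [MeasurableSpace X] in
lemma memLipLoc_of_locallyLipschitzOn {v : X → ℝ} (hv : LocallyLipschitzOn Ω v) :
    MemLipLoc Ω v := fun U _ hU hUΩ => by
  obtain ⟨L, hL⟩ := (hv.mono hUΩ).exists_lipschitzOnWith_of_compact hU
  exact ⟨L, hL.mono subset_closure⟩

omit [MeasurableSpace X] in
lemma enorm_sub_le_edist_mul {v : X → ℝ} {x y : X} {c : ℝ} (hc : 0 ≤ c)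
    (h : |v x - v y| ≤ c * dist x y) : ‖v x - v y‖ₑ ≤ edist x y * ENNReal.ofReal c := by
  rw [Real.enorm_eq_ofReal_abs, edist_dist, mul_comm, ← ENNReal.ofReal_mul hc]
  exact ENNReal.ofReal_le_ofReal h

variable [BorelSpace X]

lemma IsWhitneyCover.measurable_whitneySum (hA : IsWhitneyCover μ Ω K N A) (L : X → ℝ) (τ : ℝ) :
    Measurable (whitneySum Ω K A L τ) := by
  have : Countable A := hA.countable.to_subtype
  exact Measurable.tsum fun a =>
    (measurable_const.indicator Metric.isOpen_ball.measurableSet)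

lemma IsWhitneyCover.lintegral_whitneySum_le (hA : IsWhitneyCover μ Ω K N A) (L : X → ℝ) (τ : ℝ) :
    ∫⁻ x in Ω, whitneySum Ω K A L τ x ∂μ ≤
      ∑' a : A, ENNReal.ofReal (L a) *
        μ (Metric.ball (a : X) (τ * whitneyRadius Ω K a)) := by
  have : Countable A := hA.countable.to_subtype
  unfold whitneySum
  rw [lintegral_tsum fun a =>
    (measurable_const.indicator Metric.isOpen_ball.measurableSet).aemeasurable]
  refine ENNReal.tsum_le_tsum fun a => ?_
  rw [lintegral_indicator_const Metric.isOpen_ball.measurableSet]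
  gcongr
  exact Measure.restrict_le_self

/-- The constant `1 / (4 K)` is chosen so that admissible pairs satisfy `d(x,y) ≤ ρ(x) / 4`, the
range of the local Lipschitz bound; the gradient at `x` alone then suffices. -/
lemma IsWhitneyLipschitz.isLocalHajlaszGradient (hc : Ωᶜ.Nonempty) (hK : 100 ≤ K)
    (hA : IsWhitneyCover μ Ω K N A) {v L : X → ℝ} (hv : IsWhitneyLipschitz Ω K A v L) :
    IsLocalHajlaszGradient μ (1 / (4 * K)) Ω v (whitneySum Ω K A L 1) := by
  have hK0 : 0 < K := by linarith
  refine ⟨(hA.measurable_whitneySum L 1).aemeasurable, ∅, measure_empty, ?_⟩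
  rintro x ⟨hx, -⟩ y - hxy
  obtain ⟨a, hxa⟩ := hA.exists_mem_ball hx
  obtain ⟨hL, h⟩ := hv a a.2
  have hρ : 0 ≤ whitneyRadius Ω K x := div_nonneg Metric.infDist_nonneg hK0.le
  have hd : dist x y ≤ whitneyRadius Ω K x / 4 := by
    have h1 : edist x y ≤ ENNReal.ofReal (1 / (4 * K)) * Metric.infEDist x Ωᶜ :=
      hxy.trans (by gcongr; exact min_le_left _ _)
    rw [infEDist_compl_eq hc hK0, ← ENNReal.ofReal_mul (by positivity), edist_dist,
      ENNReal.ofReal_le_ofReal_iff (by positivity)] at h1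
    have e : 1 / (4 * K) * (K * whitneyRadius Ω K x) = whitneyRadius Ω K x / 4 := by
      field_simp
    rwa [e] at h1
  refine (enorm_sub_le_edist_mul hL (h x hxa y hd)).trans ?_
  gcongr
  exact (le_whitneySum (by rwa [one_mul])).trans le_self_add

omit [BorelSpace X] in
/-- Along one half of a uniform curve, the Lipschitz constants are controlled by the Whitney sum at
the end point. -/
lemma IsWhitneyLipschitz.abs_sub_le_along (hΩ : IsOpen Ω) (hc : Ωᶜ.Nonempty) (hK : 100 ≤ K)
    (hA : IsWhitneyCover μ Ω K N A) {v L : X → ℝ} (hv : IsWhitneyLipschitz Ω K A v L)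
    {cU : ℝ} (hcU : 0 < cU) {γ : ℝ → X} {α β : ℝ} (hαβ : α ≤ β) (hγ : LipschitzOnWith 1 γ (Icc α β))
    (hγΩ : MapsTo γ (Icc α β) Ω) {p : X}
    (hp : ∀ t ∈ Icc α β, ENNReal.ofReal (cU * dist p (γ t)) ≤ Metric.infEDist (γ t) Ωᶜ)
    (hfin : whitneySum Ω K A L (2 * K / cU + 1) p ≠ ∞) :
    |v (γ β) - v (γ α)| ≤ (whitneySum Ω K A L (2 * K / cU + 1) p).toReal * (β - α) := by
  have hK0 : 0 < K := by linarith
  refine abs_sub_le_of_locally (f := v ∘ γ) hαβ fun t ht => ?_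
  have hz := hγΩ ht
  have hρ := whitneyRadius_pos hΩ hc hK0 hz
  refine ⟨whitneyRadius Ω K (γ t) / 4, by positivity, fun s hs hst => ?_⟩
  obtain ⟨a, hza⟩ := hA.exists_mem_ball hz
  obtain ⟨hL, h⟩ := hv a a.2
  have hdist : dist (γ t) (γ s) ≤ |s - t| := by
    have := hγ.dist_le_mul t ht s hs
    rwa [NNReal.coe_one, one_mul, Real.dist_eq, abs_sub_comm] at this
  -- This fixes the dilation `2K / cU + 1`: `d(p, γ t)` is at most `K ρ(γ t) / cU ≤ 2K ρ(a) / cU`,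
  -- and `γ t` lies within `ρ(a)` of `a`.
  have hpa : p ∈ Metric.ball (a : X) ((2 * K / cU + 1) * whitneyRadius Ω K a) := by
    have h1 := hp t ht
    rw [infEDist_compl_eq hc hK0, ENNReal.ofReal_le_ofReal_iff (by positivity)] at h1
    have h2 := whitneyRadius_le_add (Ω := Ω) hK (γ t) a
    have h3 := Metric.mem_ball.1 hza
    have h4 : whitneyRadius Ω K (γ t) ≤ 2 * whitneyRadius Ω K a := by
      linarith [dist_nonneg (x := γ t) (y := (a : X))]
    have h5 : dist p (γ t) ≤ 2 * K / cU * whitneyRadius Ω K a := by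
      rw [div_mul_eq_mul_div, le_div_iff₀ hcU]
      nlinarith
    rw [Metric.mem_ball]
    linarith [dist_triangle p (γ t) a]
  have hLa : L a ≤ (whitneySum Ω K A L (2 * K / cU + 1) p).toReal := by
    rw [← ENNReal.toReal_ofReal hL]
    exact ENNReal.toReal_mono hfin (le_whitneySum hpa)
  calc |v (γ t) - v (γ s)| ≤ L a * dist (γ t) (γ s) := h _ hza _ (hdist.trans hst)
    _ ≤ _ := by gcongr

/-- The uniform curve is cut at its midpoint. On each half the distance to the nearer end point is
at most the arc length to it, which the uniform condition bounds by the distance to the complement,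
so the Whitney sum at that end point controls the half. -/
lemma IsWhitneyLipschitz.isHajlaszGradient (hΩ : IsOpen Ω) (hc : Ωᶜ.Nonempty) (hK : 100 ≤ K)
    (hA : IsWhitneyCover μ Ω K N A) {v L : X → ℝ} (hv : IsWhitneyLipschitz Ω K A v L)
    {cU : ℝ} (hU : IsUniformDomain Ω cU) :
    IsHajlaszGradient μ Ω v
      (fun x => ENNReal.ofReal cU⁻¹ * whitneySum Ω K A L (2 * K / cU + 1) x) := by
  obtain ⟨hcU, -, hU⟩ := hU
  set H := whitneySum Ω K A L (2 * K / cU + 1)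
  refine ⟨((hA.measurable_whitneySum L _).const_mul _).aemeasurable, ∅, measure_empty, ?_⟩
  rintro x ⟨hx, -⟩ y ⟨hy, -⟩
  rcases eq_or_ne x y with rfl | hxy
  · simp
  have hcU' : ENNReal.ofReal cU⁻¹ ≠ 0 := by simpa using hcU
  rw [← mul_add]
  by_cases hfin : H x + H y = ∞
  · rw [hfin, ENNReal.mul_top hcU', ENNReal.mul_top (by simpa using hxy)]
    exact le_top
  have hHx : H x ≠ ∞ := fun h => hfin (by simp [h])
  have hHy : H y ≠ ∞ := fun h => hfin (by simp [h])
  obtain ⟨γ, ℓ, hγ, h0, hℓ, hlen, hdist⟩ := hU x hx y hy hxy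
  have hℓ0 := hγ.length_pos
  have hlip := HasUnitSpeedOn.lipschitzOnWith hγ.unit_speed
  have hs1 : Icc 0 (ℓ / 2) ⊆ Icc 0 ℓ := Icc_subset_Icc_right (by linarith)
  have hs2 : Icc (ℓ / 2) ℓ ⊆ Icc 0 ℓ := Icc_subset_Icc_left (by linarith)
  have h1 := hv.abs_sub_le_along hΩ hc hK hA hcU (by linarith : (0 : ℝ) ≤ ℓ / 2) (hlip.mono hs1)
    (hγ.mapsTo.mono_left hs1) (p := x) (fun t ht => by
      refine le_trans (ENNReal.ofReal_le_ofReal ?_) (hdist t (hs1 ht))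
      have hd := hlip.dist_le_mul 0 (left_mem_Icc.2 hℓ0.le) t (hs1 ht)
      rw [h0, NNReal.coe_one, one_mul, Real.dist_eq, zero_sub, abs_neg, abs_of_nonneg ht.1] at hd
      gcongr
      exact le_min hd (by linarith [ht.2])) hHx
  have h2 := hv.abs_sub_le_along hΩ hc hK hA hcU (by linarith : ℓ / 2 ≤ ℓ) (hlip.mono hs2)
    (hγ.mapsTo.mono_left hs2) (p := y) (fun t ht => by
      refine le_trans (ENNReal.ofReal_le_ofReal ?_) (hdist t (hs2 ht))
      have hd := hlip.dist_le_mul ℓ (right_mem_Icc.2 hℓ0.le) t (hs2 ht)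
      rw [hℓ, NNReal.coe_one, one_mul, Real.dist_eq, abs_of_nonneg (by linarith [ht.2])] at hd
      gcongr
      exact le_min (by linarith [ht.1]) hd) hHy
  rw [h0] at h1
  rw [hℓ] at h2
  have hmain : |v x - v y| ≤ cU⁻¹ * ((H x).toReal + (H y).toReal) * dist x y := by
    have e : |v x - v y| ≤ |v (γ (ℓ / 2)) - v x| + |v y - v (γ (ℓ / 2))| := by
      rw [abs_sub_comm (v (γ (ℓ / 2))), abs_sub_comm (v y)]
      exact abs_sub_le _ _ _
    have hsum : 0 ≤ (H x).toReal + (H y).toReal := by positivity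
    calc |v x - v y| ≤ (H x).toReal * (ℓ / 2 - 0) + (H y).toReal * (ℓ - ℓ / 2) :=
          e.trans (add_le_add h1 h2)
      _ = ((H x).toReal + (H y).toReal) * (ℓ / 2) := by ring
      _ ≤ ((H x).toReal + (H y).toReal) * (cU⁻¹ * dist x y) := by gcongr; linarith
      _ = _ := by ring
  refine (enorm_sub_le_edist_mul (by positivity) hmain).trans (le_of_eq ?_)
  rw [ENNReal.ofReal_mul (by positivity), ENNReal.ofReal_add (by positivity) (by positivity),
    ENNReal.ofReal_toReal hHx, ENNReal.ofReal_toReal hHy]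

end

/-! ### The Whitney smoothing: integral bounds, traces and Lipschitz constants -/

section

variable {X : Type*} [MetricSpace X] [MeasurableSpace X] [BorelSpace X] {μ : Measure X}
  {Ω A : Set X} {K : ℝ} {N : ℝ≥0∞} {Cd CP : ℝ≥0} {u : X → EReal}

/-- The smoothing of `u` in `Ω` by tent means at the Whitney scale. -/
noncomputable def whitneySmoothing (μ : Measure X) (Ω : Set X) (K : ℝ) (u : X → EReal) (x : X) :
    ℝ :=
  tentMean μ (Ω.indicator fun y => (u y).toReal) (whitneyRadius Ω K x) x

lemma integrable_indicator_toReal (hΩ : IsOpen Ω) (hum : AEMeasurable u (μ.restrict Ω))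
    (hu : ∫⁻ x in Ω, (u x).abs ∂μ < ∞) :
    Integrable (Ω.indicator fun y => (u y).toReal) μ := by
  refine (integrable_indicator_iff hΩ.measurableSet).2 ⟨hum.ereal_toReal.aestronglyMeasurable, ?_⟩
  refine lt_of_le_of_lt (lintegral_mono fun x => ?_) hu
  simpa using enorm_toReal_sub_le (u x) 0

omit [MetricSpace X] [BorelSpace X] in
lemma lintegral_indicator_toReal_sub_le {B : Set X} (hB : MeasurableSet B) (hBΩ : B ⊆ Ω) (t : ℝ) :
    ∫⁻ y in B, ‖Ω.indicator (fun y => (u y).toReal) y - t‖ₑ ∂μ ≤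
      ∫⁻ y in B, (u y - (t : EReal)).abs ∂μ :=
  setLIntegral_mono_ae' hB (Eventually.of_forall fun y hy => by
    rw [indicator_of_mem (hBΩ hy)]; exact enorm_toReal_sub_le _ _)

omit [BorelSpace X] in
lemma IsDoubling.ofReal_integral_abs_sub (hd : IsDoubling μ Cd) {w : X → ℝ} (hw : Integrable w μ)
    (m : ℝ) (x : X) (r : ℝ) :
    ENNReal.ofReal (∫ y in Metric.ball x r, |w y - m| ∂μ) =
      ∫⁻ y in Metric.ball x r, ‖w y - m‖ₑ ∂μ :=
  ofReal_integral_norm_eq_lintegral_enorm (hd.integrableOn_ball_sub hw m x r)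

lemma lintegral_ball_smoothing_sub_le (hd : IsDoubling μ Cd) (hΩ : IsOpen Ω) (hc : Ωᶜ.Nonempty)
    (hK : 100 ≤ K) (hum : AEMeasurable u (μ.restrict Ω)) (hu : ∫⁻ x in Ω, (u x).abs ∂μ < ∞)
    (t : ℝ) {a : X} (ha : a ∈ Ω) :
    ∫⁻ x in Metric.ball a (whitneyRadius Ω K a), ‖whitneySmoothing μ Ω K u x - t‖ₑ ∂μ ≤
      2 * Cd ^ 3 * ∫⁻ y in Metric.ball a (K / 20 * whitneyRadius Ω K a),
        (u y - (t : EReal)).abs ∂μ := by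
  have hK0 : 0 < K := by linarith
  have hρ := whitneyRadius_pos hΩ hc hK0 ha
  have hKρ : 100 * whitneyRadius Ω K a ≤ K * whitneyRadius Ω K a := by gcongr
  set w := Ω.indicator fun y => (u y).toReal
  have hw : Integrable w μ := integrable_indicator_toReal hΩ hum hu
  set B := Metric.ball a (K / 20 * whitneyRadius Ω K a)
  have hBΩ : B ⊆ Ω := Metric.ball_subset_closedBall.trans (closedBall_subset_of_lt_infDist (by
    rw [← mul_whitneyRadius hK0]; nlinarith))
  set J := ∫ y in B, |w y - t| ∂μ
  have hJ : ENNReal.ofReal J ≤ ∫⁻ y in B, (u y - (t : EReal)).abs ∂μ :=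
    (hd.ofReal_integral_abs_sub hw t _ _).trans_le
      (lintegral_indicator_toReal_sub_le Metric.isOpen_ball.measurableSet hBΩ t)
  have hJ0 : 0 ≤ J := integral_nonneg fun y => abs_nonneg _
  set b := μ.real (Metric.ball a (whitneyRadius Ω K a))
  have hb : 0 < b := hd.measureReal_ball_pos a hρ
  have hpt : ∀ x ∈ Metric.ball a (whitneyRadius Ω K a),
      ‖whitneySmoothing μ Ω K u x - t‖ₑ ≤ ENNReal.ofReal (2 * Cd ^ 3 * J / b) := by
    intro x hx
    rw [Metric.mem_ball] at hx
    have h1 := whitneyRadius_le_add (Ω := Ω) hK a x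
    have h2 := whitneyRadius_le_add (Ω := Ω) hK x a
    rw [dist_comm] at h1
    have hρx : 0 < whitneyRadius Ω K x := by linarith
    rw [Real.enorm_eq_ofReal_abs]
    refine ENNReal.ofReal_le_ofReal ((hd.abs_tentMean_sub_le hw t hρx x).trans ?_)
    have h3 : ∫ y in Metric.ball x (whitneyRadius Ω K x), |w y - t| ∂μ ≤ J :=
      setIntegral_mono_set (hd.integrableOn_ball_sub hw t _ _).abs
        (Eventually.of_forall fun y => abs_nonneg _)
        (LE.le.eventuallyLE (Metric.ball_subset_ball' (by linarith)))
    have h4 : b ≤ (Cd : ℝ) ^ 3 * μ.real (Metric.ball x (whitneyRadius Ω K x / 2)) :=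
      hd.measureReal_ball_le (by positivity) 3 (by rw [dist_comm]; linarith)
    rw [div_le_div_iff₀ (hd.measureReal_ball_pos x (by positivity)) hb]
    calc _ ≤ 2 * J * ((Cd : ℝ) ^ 3 * μ.real (Metric.ball x (whitneyRadius Ω K x / 2))) := by gcongr
      _ = _ := by ring
  calc _ ≤ ∫⁻ x in Metric.ball a (whitneyRadius Ω K a), ENNReal.ofReal (2 * Cd ^ 3 * J / b) ∂μ :=
        setLIntegral_mono_ae' Metric.isOpen_ball.measurableSet (Eventually.of_forall hpt)
    _ = ENNReal.ofReal (2 * Cd ^ 3 * J / b) * ENNReal.ofReal b := by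
        rw [setLIntegral_const, ofReal_measureReal (hd.measure_ball_lt_top a _).ne]
    _ = 2 * Cd ^ 3 * ENNReal.ofReal J := by
        rw [← ENNReal.ofReal_mul (by positivity), div_mul_cancel₀ _ hb.ne',
          ENNReal.ofReal_mul (by positivity), ENNReal.ofReal_mul (by positivity),
          ENNReal.ofReal_pow (by positivity), ENNReal.ofReal_coe_nnreal]
        simp
    _ ≤ _ := by gcongr

/-- The deviation of the smoothing from a constant is controlled by that of `u`, uniformly over
sets stable under Whitney dilations. -/
lemma IsWhitneyCover.lintegral_smoothing_sub_le (hA : IsWhitneyCover μ Ω K N A)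
    (hd : IsDoubling μ Cd) (hΩ : IsOpen Ω) (hc : Ωᶜ.Nonempty)
    (hK : 100 ≤ K) (hum : AEMeasurable u (μ.restrict Ω)) (hu : ∫⁻ x in Ω, (u x).abs ∂μ < ∞)
    (t : ℝ) {S S' : Set X} (hS : MeasurableSet S')
    (hSS : ∀ a ∈ Ω, (Metric.ball a (whitneyRadius Ω K a) ∩ S).Nonempty →
      Metric.ball a (K / 20 * whitneyRadius Ω K a) ⊆ S') :
    ∫⁻ x in S ∩ Ω, ‖whitneySmoothing μ Ω K u x - t‖ₑ ∂μ ≤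
      2 * Cd ^ 3 * N * ∫⁻ y in S' ∩ Ω, (u y - (t : EReal)).abs ∂μ := by
  have : Countable A := hA.countable.to_subtype
  have hcov : S ∩ Ω ⊆ ⋃ a : A, Metric.ball (a : X) (whitneyRadius Ω K a) ∩ S := fun x hx => by
    obtain ⟨a, ha⟩ := hA.exists_mem_ball hx.2
    exact mem_iUnion.2 ⟨a, ha, hx.1⟩
  refine (lintegral_mono_set hcov).trans ((lintegral_iUnion_le _ _).trans ?_)
  -- Inserting the indicator of `S'` costs nothing on the relevant balls, and it confines the
  -- overlap estimate to `S' ∩ Ω`.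
  have hball : ∀ a : A, ∫⁻ x in Metric.ball (a : X) (whitneyRadius Ω K a) ∩ S,
      ‖whitneySmoothing μ Ω K u x - t‖ₑ ∂μ ≤
      2 * Cd ^ 3 * ∫⁻ y in Metric.ball (a : X) (K / 20 * whitneyRadius Ω K a),
        S'.indicator (fun y => (u y - (t : EReal)).abs) y ∂μ := fun a => by
    rcases (Metric.ball (a : X) (whitneyRadius Ω K a) ∩ S).eq_empty_or_nonempty with he | hne
    · simp [he]
    · refine (lintegral_mono_set inter_subset_left).trans
        ((lintegral_ball_smoothing_sub_le hd hΩ hc hK hum hu t (hA.subset a.2)).trans ?_)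
      gcongr 2 * _ ^ 3 * ?_
      refine (setLIntegral_congr_fun Metric.isOpen_ball.measurableSet fun y hy => ?_).le
      rw [indicator_of_mem (hSS a (hA.subset a.2) hne hy)]
  refine (ENNReal.tsum_le_tsum hball).trans ?_
  rw [ENNReal.tsum_mul_left, mul_assoc _ N]
  gcongr
  refine (hA.tsum_lintegral_le _).trans (le_of_eq ?_)
  rw [lintegral_indicator hS, Measure.restrict_restrict hS]

/-- If a Whitney ball meets `B(x,r)` at `z`, then `d(z, X \ Ω) ≤ d(z,x) < r` because `x` is not in
`Ω`, so its dilation stays in `B(x,2r)`. Doubling of `μ` on `Ω` compares the two normalisations. -/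
lemma IsWhitneyCover.hasTraceAt_smoothing (hA : IsWhitneyCover μ Ω K N A) (hN : N ≠ ∞)
    (hd : IsDoubling μ Cd) (hΩ : IsOpen Ω) (hc : Ωᶜ.Nonempty) (hdΩ : IsDoublingOn μ Ω)
    (hK : 100 ≤ K) (hum : AEMeasurable u (μ.restrict Ω)) (hu : ∫⁻ x in Ω, (u x).abs ∂μ < ∞)
    {t : ℝ} {x : X} (hx : x ∈ frontier Ω) (ht : HasTraceAt μ Ω u x t) :
    HasTraceAt μ Ω (fun y => (whitneySmoothing μ Ω K u y : EReal)) x t := by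
  obtain ⟨c, hc'⟩ := hdΩ
  have hK0 : 0 < K := by linarith
  have hxΩ : x ∈ Ωᶜ := by
    rw [hΩ.frontier_eq] at hx; exact hx.2
  have htwo : Tendsto (fun r : ℝ => 2 * r) (𝓝[>] 0) (𝓝[>] 0) := by
    refine tendsto_nhdsWithin_iff.2 ⟨?_, ?_⟩
    · have : Continuous fun r : ℝ => 2 * r := by fun_prop
      simpa using (this.tendsto 0).mono_left nhdsWithin_le_nhds
    · filter_upwards [self_mem_nhdsWithin] with r hr
      simpa using hr
  have hlim := ENNReal.Tendsto.const_mul (a := 2 * (Cd : ℝ≥0∞) ^ 3 * N * c) (ht.comp htwo)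
    (Or.inr (by finiteness))
  rw [mul_zero] at hlim
  refine tendsto_of_tendsto_of_tendsto_of_le_of_le' tendsto_const_nhds hlim
    (Eventually.of_forall fun r => zero_le) ?_
  filter_upwards [self_mem_nhdsWithin] with r (hr : 0 < r)
  obtain ⟨hpos2, hle, hfin⟩ := hc' x (frontier_subset_closure hx) r hr
  have hfin2 := (hc' x (frontier_subset_closure hx) (2 * r) (by positivity)).2.2
  have hpos : 0 < μ (Metric.ball x r ∩ Ω) := by
    rcases eq_or_ne (μ (Metric.ball x r ∩ Ω)) 0 with h | h
    · rw [h, mul_zero] at hle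
      exact absurd hle (not_le.2 hpos2)
    · exact pos_iff_ne_zero.2 h
  have e : ∀ y, ((whitneySmoothing μ Ω K u y : EReal) - (t : EReal)).abs =
      ‖whitneySmoothing μ Ω K u y - t‖ₑ := fun y => by
    rw [← EReal.coe_sub, EReal.abs_def, Real.enorm_eq_ofReal_abs]
  simp only [e, Function.comp, setLAverage_eq]
  have hmain := hA.lintegral_smoothing_sub_le hd hΩ hc hK hum hu t (S := Metric.ball x r)
    (S' := Metric.ball x (2 * r)) Metric.isOpen_ball.measurableSet (by
      rintro a ha ⟨z, hza, hzx⟩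
      rw [Metric.mem_ball] at hza hzx
      have h1 := Metric.infDist_le_dist_of_mem (x := z) hxΩ
      rw [← mul_whitneyRadius hK0] at h1
      have h2 := whitneyRadius_le_add (Ω := Ω) hK a z
      have h3 := dist_triangle_left a x z
      have hρ := whitneyRadius_pos hΩ hc hK0 ha
      rw [dist_comm a z] at h2
      have h4 : whitneyRadius Ω K a ≤ 2 * whitneyRadius Ω K z := by linarith
      have h5 : K * whitneyRadius Ω K a ≤ K * (2 * whitneyRadius Ω K z) := by gcongr
      have h6 : 100 * whitneyRadius Ω K a ≤ K * whitneyRadius Ω K a := by gcongr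
      refine Metric.ball_subset_ball' ?_
      linarith)
  rw [ENNReal.div_le_iff hpos.ne' hfin.ne]
  refine hmain.trans ?_
  rw [mul_assoc _ (c : ℝ≥0∞), mul_assoc _ (_ * _ : ℝ≥0∞)]
  gcongr
  set I := ∫⁻ y in Metric.ball x (2 * r) ∩ Ω, (u y - (t : EReal)).abs ∂μ
  calc I = I / μ (Metric.ball x (2 * r) ∩ Ω) * μ (Metric.ball x (2 * r) ∩ Ω) :=
        (ENNReal.div_mul_cancel hpos2.ne' hfin2.ne).symm
    _ ≤ I / μ (Metric.ball x (2 * r) ∩ Ω) * (c * μ (Metric.ball x r ∩ Ω)) := by gcongr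
    _ = _ := by ring

/-- The Lipschitz constant of the smoothing on the Whitney ball centred at `a`, in terms of an
upper gradient `G`. -/
noncomputable def smoothingConstant (μ : Measure X) (Ω : Set X) (K : ℝ) (Cd CP : ℝ≥0)
    (G : X → ℝ≥0∞) (a : X) : ℝ :=
  24 * (Cd : ℝ) ^ 7 * CP *
    (∫⁻ y in Metric.ball a (K / 20 * whitneyRadius Ω K a), G y ∂μ).toReal /
      μ.real (Metric.ball a (whitneyRadius Ω K a))

/-- The oscillation estimate for tent means, combined with the Poincaré inequality on `B(x,2r)`. The
oscillation estimate supplies `12 Cd⁶`, the radius `2r` a factor `2`, and the comparison of `B(a,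
ρ(a))` with `B(x,2r)` the last `Cd`. -/
lemma isWhitneyLipschitz_smoothing {lam : ℝ} (hd : IsDoubling μ Cd)
    (hP : SupportsPoincare μ CP lam) (hlam : 1 ≤ lam) (hΩ : IsOpen Ω) (hc : Ωᶜ.Nonempty)
    (hA : A ⊆ Ω) (hum : AEMeasurable u (μ.restrict Ω)) (hu : ∫⁻ x in Ω, (u x).abs ∂μ < ∞)
    {G : X → ℝ≥0∞} (hGm : Measurable G)
    (hG : ∀ (γ : ℝ → X) (ℓ : ℝ), IsCurveIn Ω γ ℓ → UpperGradientIneq u G γ ℓ)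
    (hGfin : ∫⁻ x in Ω, G x ∂μ < ∞) :
    IsWhitneyLipschitz Ω (100 * lam) A (whitneySmoothing μ Ω (100 * lam) u)
      (smoothingConstant μ Ω (100 * lam) Cd CP G) := by
  set K := 100 * lam with hKdef
  have hK : 100 ≤ K := by linarith
  have hK0 : 0 < K := by linarith
  intro a ha
  refine ⟨by unfold smoothingConstant; positivity, fun x hx y hxy => ?_⟩
  set w := Ω.indicator fun y => (u y).toReal
  have hw : Integrable w μ := integrable_indicator_toReal hΩ hum hu
  have hρ := whitneyRadius_pos hΩ hc hK0 (hA ha)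
  rw [Metric.mem_ball] at hx
  have h1 := whitneyRadius_le_add (Ω := Ω) hK a x
  have h2 := whitneyRadius_le_add (Ω := Ω) hK x a
  have h3 := whitneyRadius_le_add (Ω := Ω) hK x y
  rw [dist_comm] at h1
  set ra := whitneyRadius Ω K a
  set r := whitneyRadius Ω K x
  set r' := whitneyRadius Ω K y
  have hr : 0 < r := by linarith
  have hr' : 0 < r' := by linarith
  have hlr : r ≤ lam * r := le_mul_of_one_le_left hr.le hlam
  have hlra : ra ≤ lam * ra := le_mul_of_one_le_left hρ.le hlam
  have hl2 : lam * r ≤ lam * (2 * ra) := by gcongr; linarith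
  -- With `r ≤ 2 ρ(a)` the ball on the left lies within `4 λ ρ(a) + ρ(a) ≤ 5 λ ρ(a) = K ρ(a) / 20`
  -- of `a`; this is why `K = 100 λ`.
  have hBa : Metric.ball x (lam * (2 * r)) ⊆ Metric.ball a (K / 20 * ra) :=
    Metric.ball_subset_ball' (by rw [hKdef]; linarith)
  have hBaΩ : Metric.ball a (K / 20 * ra) ⊆ Ω :=
    Metric.ball_subset_closedBall.trans (closedBall_subset_of_lt_infDist (by
      rw [← mul_whitneyRadius hK0]; change _ < K * ra; nlinarith))
  have hB : Metric.closedBall x (lam * (2 * r)) ⊆ Ω := closedBall_subset_of_lt_infDist (by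
    rw [← mul_whitneyRadius hK0]; change _ < K * r; rw [hKdef]; linarith)
  have hBx : Metric.ball x (2 * r) ⊆ Ω :=
    (Metric.ball_subset_ball (by linarith)).trans (Metric.ball_subset_closedBall.trans hB)
  obtain ⟨m, hm⟩ := hP.exists_lintegral_le hlam hd hΩ hum hu hGm hG (by positivity) hB
  set I := ∫⁻ y in Metric.ball a (K / 20 * ra), G y ∂μ
  have hI : I ≠ ∞ := ((lintegral_mono_set hBaΩ).trans_lt hGfin).ne
  set J := ∫ y in Metric.ball x (2 * r), |w y - m| ∂μ
  have hJ : J ≤ CP * (2 * r) * I.toReal := by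
    have h : ENNReal.ofReal J ≤ CP * ENNReal.ofReal (2 * r) * I :=
      (hd.ofReal_integral_abs_sub hw m x (2 * r)).trans_le
      ((lintegral_indicator_toReal_sub_le Metric.isOpen_ball.measurableSet hBx m).trans
        (hm.trans (mul_le_mul_right (lintegral_mono_set hBa) _)))
    rw [← ENNReal.ofReal_toReal hI, ← ENNReal.ofReal_coe_nnreal,
      ← ENNReal.ofReal_mul (by positivity), ← ENNReal.ofReal_mul (by positivity)] at h
    exact (ENNReal.ofReal_le_ofReal_iff (by positivity)).1 h
  have hrr : |r - r'| ≤ dist x y := by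
    have h := abs_whitneyRadius_sub_le (Ω := Ω) hK0 x y
    exact le_trans (le_mul_of_one_le_left (abs_nonneg _) (by linarith)) h
  have hosc := hd.abs_tentMean_sub_tentMean_le hw m hr hr' hxy hrr
  have hb := hd.measureReal_ball_pos a hρ
  have hb2 := hd.measureReal_ball_pos x (show 0 < 2 * r by positivity)
  have hbb : μ.real (Metric.ball a ra) ≤ (Cd : ℝ) ^ 1 * μ.real (Metric.ball x (2 * r)) :=
    hd.measureReal_ball_le (by positivity) 1 (by rw [dist_comm]; linarith)
  refine hosc.trans ?_
  have hinv : 1 / μ.real (Metric.ball x (2 * r)) ≤ Cd / μ.real (Metric.ball a ra) := by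
    rw [div_le_div_iff₀ hb2 hb]; linarith
  calc 12 * (Cd : ℝ) ^ 6 * (dist x y * J / (r * μ.real (Metric.ball x (2 * r))))
      ≤ 12 * (Cd : ℝ) ^ 6 * (dist x y * (CP * (2 * r) * I.toReal) /
        (r * μ.real (Metric.ball x (2 * r)))) := by gcongr
    _ = 24 * (Cd : ℝ) ^ 6 * CP * I.toReal * dist x y *
        (1 / μ.real (Metric.ball x (2 * r))) := by field_simp; ring
    _ ≤ 24 * (Cd : ℝ) ^ 6 * CP * I.toReal * dist x y * (Cd / μ.real (Metric.ball a ra)) := by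
        gcongr
    _ = _ := by unfold smoothingConstant; ring

/-- Doubling replaces the `τ`-dilated balls by the original ones, where `L a` times the measure is a
multiple of an integral of `G` over the `K / 20` dilation. Hence only the overlap of these fixed
dilations matters, however large `τ` is. -/
lemma IsWhitneyCover.lintegral_smoothingGradient_le (hA : IsWhitneyCover μ Ω K N A)
    (hd : IsDoubling μ Cd) (hΩ : IsOpen Ω) (hc : Ωᶜ.Nonempty)
    (hK : 100 ≤ K) {G : X → ℝ≥0∞} {τ : ℝ} {n : ℕ} (hτ : τ ≤ 2 ^ n) :
    ∫⁻ x in Ω, whitneySum Ω K A (smoothingConstant μ Ω K Cd CP G) τ x ∂μ ≤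
      24 * Cd ^ 7 * CP * Cd ^ n * N * ∫⁻ x in Ω, G x ∂μ := by
  have hK0 : 0 < K := by linarith
  refine (hA.lintegral_whitneySum_le _ τ).trans ?_
  rw [mul_assoc _ N]
  refine le_trans ?_ (mul_le_mul_right (hA.tsum_lintegral_le G) _)
  rw [← ENNReal.tsum_mul_left]
  refine ENNReal.tsum_le_tsum fun a => ?_
  have hρ := whitneyRadius_pos hΩ hc hK0 (hA.subset a.2)
  have hb := hd.measureReal_ball_pos (a : X) hρ
  set I := ∫⁻ y in Metric.ball (a : X) (K / 20 * whitneyRadius Ω K a), G y ∂μ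
  have h1 : μ (Metric.ball (a : X) (τ * whitneyRadius Ω K a)) ≤
      (Cd : ℝ≥0∞) ^ n * μ (Metric.ball (a : X) (whitneyRadius Ω K a)) :=
    hd.measure_ball_le hρ n (by rw [dist_self, zero_add]; gcongr)
  have h2 : ENNReal.ofReal (smoothingConstant μ Ω K Cd CP G a) *
      μ (Metric.ball (a : X) (whitneyRadius Ω K a)) ≤ 24 * Cd ^ 7 * CP * I := by
    rw [← ENNReal.ofReal_toReal (hd.measure_ball_lt_top (a : X) _).ne,
      ← ENNReal.ofReal_mul (by unfold smoothingConstant; positivity)]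
    have e : smoothingConstant μ Ω K Cd CP G a *
        (μ (Metric.ball (a : X) (whitneyRadius Ω K a))).toReal =
        24 * (Cd : ℝ) ^ 7 * CP * I.toReal := div_mul_cancel₀ _ hb.ne'
    rw [e, ENNReal.ofReal_mul (by positivity), ENNReal.ofReal_mul (by positivity),
      ENNReal.ofReal_mul (by positivity), ENNReal.ofReal_pow (by positivity),
      ENNReal.ofReal_coe_nnreal, ENNReal.ofReal_coe_nnreal]
    simp only [ENNReal.ofReal_ofNat]
    gcongr
    exact ENNReal.ofReal_toReal_le
  calc _ ≤ ENNReal.ofReal (smoothingConstant μ Ω K Cd CP G a) *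
        ((Cd : ℝ≥0∞) ^ n * μ (Metric.ball (a : X) (whitneyRadius Ω K a))) := by gcongr
    _ = (Cd : ℝ≥0∞) ^ n * (ENNReal.ofReal (smoothingConstant μ Ω K Cd CP G a) *
        μ (Metric.ball (a : X) (whitneyRadius Ω K a))) := by ring
    _ ≤ (Cd : ℝ≥0∞) ^ n * (24 * Cd ^ 7 * CP * I) := by gcongr
    _ = _ := by ring

end

/-! ### Infimum over upper gradients and the theorem -/

lemma le_mul_of_forall_pos_le_mul_add {a b C : ℝ≥0∞} (hC : C ≠ ∞)
    (h : ∀ δ : ℝ≥0, 0 < δ → a ≤ C * (b + δ)) : a ≤ C * b := by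
  refine ENNReal.le_of_forall_pos_le_add fun ε hε _ => ?_
  obtain ⟨δ, hδ, hδε⟩ := ENNReal.exists_nnreal_pos_mul_lt hC
    (show (ε : ℝ≥0∞) ≠ 0 by exact_mod_cast hε.ne')
  refine (h δ hδ).trans ?_
  rw [mul_add, mul_comm C δ]
  gcongr

section

variable {X : Type*} [MetricSpace X] [MeasurableSpace X] {μ : Measure X} {Ω : Set X}
  {u : X → EReal}

/-- Half of `δ` pays for a near minimiser of the infimum, half for replacing it by a Borel function
valid along all curves. -/
lemma exists_upperGradient_lintegral_le
    (hI : (⨅ (g : X → ℝ≥0∞) (_ : IsWeakUpperGradientOn μ Ω u g), ∫⁻ x in Ω, g x ∂μ) < ∞)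
    {δ : ℝ≥0} (hδ : 0 < δ) :
    ∃ G : X → ℝ≥0∞, Measurable G ∧
      (∀ (γ : ℝ → X) (ℓ : ℝ), IsCurveIn Ω γ ℓ → UpperGradientIneq u G γ ℓ) ∧
      ∫⁻ x in Ω, G x ∂μ ≤
        (⨅ (g : X → ℝ≥0∞) (_ : IsWeakUpperGradientOn μ Ω u g), ∫⁻ x in Ω, g x ∂μ) + δ := by
  set I := ⨅ (g : X → ℝ≥0∞) (_ : IsWeakUpperGradientOn μ Ω u g), ∫⁻ x in Ω, g x ∂μ with hIdef
  have hδ2 : ((δ / 2 : ℝ≥0) : ℝ≥0∞) ≠ 0 := by exact_mod_cast (half_pos hδ).ne'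
  have hlt : I < I + (δ / 2 : ℝ≥0) := ENNReal.lt_add_right hI.ne hδ2
  obtain ⟨g, hg⟩ := iInf_lt_iff.1 (hIdef ▸ hlt)
  obtain ⟨hg, hgI⟩ := iInf_lt_iff.1 hg
  obtain ⟨G, hGm, hG, hGI⟩ := hg.exists_measurable_ge hδ2
  refine ⟨G, hGm, hG, hGI.trans ?_⟩
  calc _ ≤ I + (δ / 2 : ℝ≥0) + (δ / 2 : ℝ≥0) := by gcongr
    _ = I + δ := by rw [add_assoc, ← ENNReal.coe_add, add_halves]

lemma normM11Local_zero (c : ℝ) : normM11Local μ c Ω (fun _ => 0) = 0 := by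
  have h : IsLocalHajlaszGradient μ c Ω (fun _ => 0) 0 :=
    ⟨aemeasurable_const, ∅, measure_empty, fun x _ y _ _ => by simp⟩
  have h2 := iInf₂_le (f := fun (g : X → ℝ≥0∞)
    (_ : IsLocalHajlaszGradient μ c Ω (fun _ => 0) g) => ∫⁻ x in Ω, g x ∂μ) 0 h
  unfold normM11Local
  simpa using h2

lemma normM11_zero : normM11 μ Ω (fun _ => 0) = 0 := by
  have h : IsHajlaszGradient μ Ω (fun _ => 0) 0 :=
    ⟨aemeasurable_const, ∅, measure_empty, fun x _ y _ => by simp⟩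
  have h2 := iInf₂_le (f := fun (g : X → ℝ≥0∞)
    (_ : IsHajlaszGradient μ Ω (fun _ => 0) g) => ∫⁻ x in Ω, g x ∂μ) 0 h
  unfold normM11
  simpa using h2

end

end MetricTrace

theorem theorem1p6 (lam : ℝ) (hlam : 1 ≤ lam) :
    -- `cH` depends only on `lam`
    ∃ cH : ℝ, 0 < cH ∧ cH < 1 ∧ ∀ Cd CP : ℝ≥0,
    -- `C` depends only on `lam, Cd, CP`; in a uniform domain the constant depends also on `cU`
    ∃ (C : ℝ≥0) (C' : ℝ → ℝ≥0),
    ∀ (X : Type*) [MetricSpace X] [CompleteSpace X] [MeasurableSpace X] [BorelSpace X]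
      (μ : Measure X), IsDoubling μ Cd → SupportsPoincare μ CP lam →
    ∀ Ω : Set X, IsOpen Ω → Ω.Nonempty → IsDoublingOn μ Ω →
    ∀ (ν : Measure (frontier Ω)) [ν.Regular] (u : X → EReal) (Tu : frontier Ω → ℝ),
      MemN11 μ Ω u → (∀ᵐ x : frontier Ω ∂ν, HasTraceAt μ Ω u x (Tu x)) →
    ∃ v : X → ℝ,
      MemM11Local μ cH Ω v ∧ MemLipLoc Ω v ∧
      normM11Local μ cH Ω v ≤ C * normN11 μ Ω u ∧
      (∀ᵐ x : frontier Ω ∂ν, HasTraceAt μ Ω (fun y => (v y : EReal)) x (Tu x)) ∧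
      ∀ cU : ℝ, IsUniformDomain Ω cU →
        MemM11 μ Ω v ∧ normM11 μ Ω v ≤ C' cU * normN11 μ Ω u := by
  set K := 100 * lam with hKdef
  have hK : 100 ≤ K := by linarith
  have hK0 : 0 < K := by linarith
  have hpow : ∀ t : ℝ, t ≤ 2 ^ ⌈t⌉₊ := fun t =>
    (Nat.le_ceil t).trans (by exact_mod_cast Nat.lt_two_pow_self.le)
  refine ⟨1 / (4 * K), by positivity, by rw [div_lt_one (by positivity)]; linarith,
    fun Cd CP => ?_⟩
  set C₁ : ℝ≥0 := 2 * Cd ^ 3 * Cd ^ ⌈K⌉₊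
  set C₂ : ℕ → ℝ≥0 := fun n => 24 * Cd ^ 7 * CP * Cd ^ n * Cd ^ ⌈K⌉₊
  set C₃ : ℝ → ℝ≥0 := fun cU => cU⁻¹.toNNReal * C₂ ⌈2 * K / cU + 1⌉₊
  refine ⟨C₁ + C₂ 0, fun cU => C₁ + C₃ cU, ?_⟩
  intro X _ _ _ _ μ hd hP Ω hΩ _ hdΩ ν _ u Tu hu hTu
  -- If `Ω = X`, the boundary is empty and the trace condition is void, so `v = 0` works; otherwise
  -- all Whitney radii in `Ω` are positive.
  rcases Ωᶜ.eq_empty_or_nonempty with hc | hc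
  · rw [compl_empty_iff] at hc
    refine ⟨fun _ => 0, ⟨aemeasurable_const, by simp [normM11Local_zero]⟩,
      fun U _ _ _ => ⟨0, (LipschitzWith.const (0 : ℝ)).lipschitzOnWith⟩, by simp [normM11Local_zero],
      Eventually.of_forall fun x => ?_, fun cU _ =>
      ⟨⟨aemeasurable_const, by simp [normM11_zero]⟩, by simp [normM11_zero]⟩⟩
    exact absurd x.2 (by simp [hc])
  obtain ⟨hum, hnorm⟩ := hu
  have hnorm' := hnorm
  unfold normN11 at hnorm'
  obtain ⟨huL, hI⟩ := ENNReal.add_lt_top.1 hnorm'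
  obtain ⟨A, hA⟩ := exists_isWhitneyCover hd hΩ hc hK (hpow K)
  set v := whitneySmoothing μ Ω K u
  -- Since `v` is defined without reference to a gradient, the same `v` can be tested against every
  -- `G`; this is what permits the infimum in the norm of `u`.
  have hlip : ∀ G : X → ℝ≥0∞, Measurable G →
      (∀ (γ : ℝ → X) (ℓ : ℝ), IsCurveIn Ω γ ℓ → UpperGradientIneq u G γ ℓ) →
      ∫⁻ x in Ω, G x ∂μ < ∞ →
      IsWhitneyLipschitz Ω K A v (smoothingConstant μ Ω K Cd CP G) := fun G hGm hG hGf =>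
    isWhitneyLipschitz_smoothing hd hP hlam hΩ hc hA.subset hum huL hGm hG hGf
  have hloc : LocallyLipschitzOn Ω v := by
    obtain ⟨G, hGm, hG, hGI⟩ := exists_upperGradient_lintegral_le hI one_pos
    exact (hlip G hGm hG (hGI.trans_lt (by finiteness))).locallyLipschitzOn hΩ hc hK hA
  have hvm : AEMeasurable v (μ.restrict Ω) := hloc.continuousOn.aemeasurable hΩ.measurableSet
  have hvL : ∫⁻ x in Ω, ‖v x‖ₑ ∂μ ≤ C₁ * ∫⁻ x in Ω, (u x).abs ∂μ := by
    have h := hA.lintegral_smoothing_sub_le hd hΩ hc hK hum huL 0 (S := univ) (S' := univ)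
      MeasurableSet.univ (fun _ _ _ => subset_univ _)
    simpa [C₁] using h
  have hlocal : normM11Local μ (1 / (4 * K)) Ω v ≤ (C₁ + C₂ 0 : ℝ≥0) * normN11 μ Ω u := by
    unfold normM11Local normN11
    rw [mul_add]
    refine add_le_add (hvL.trans (by gcongr; exact le_self_add)) ?_
    refine le_mul_of_forall_pos_le_mul_add ENNReal.coe_ne_top fun δ hδ => ?_
    obtain ⟨G, hGm, hG, hGI⟩ := exists_upperGradient_lintegral_le hI hδ
    have hL := hlip G hGm hG (hGI.trans_lt (by finiteness))
    refine (iInf₂_le _ (hL.isLocalHajlaszGradient hc hK hA)).trans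
      ((hA.lintegral_smoothingGradient_le hd hΩ hc hK (n := 0) (by simp)).trans ?_)
    have e : 24 * (Cd : ℝ≥0∞) ^ 7 * CP * Cd ^ 0 * Cd ^ ⌈K⌉₊ = (C₂ 0 : ℝ≥0) := by
      simp [C₂]
    rw [e]
    gcongr
    exact le_add_self
  have huniform : ∀ cU : ℝ, IsUniformDomain Ω cU →
      normM11 μ Ω v ≤ (C₁ + C₃ cU : ℝ≥0) * normN11 μ Ω u := by
    intro cU hU
    unfold normM11 normN11
    rw [mul_add]
    refine add_le_add (hvL.trans (by gcongr; exact le_self_add)) ?_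
    refine le_mul_of_forall_pos_le_mul_add ENNReal.coe_ne_top fun δ hδ => ?_
    obtain ⟨G, hGm, hG, hGI⟩ := exists_upperGradient_lintegral_le hI hδ
    have hL := hlip G hGm hG (hGI.trans_lt (by finiteness))
    refine (iInf₂_le _ (hL.isHajlaszGradient hΩ hc hK hA hU)).trans ?_
    rw [lintegral_const_mul' _ _ ENNReal.ofReal_ne_top]
    refine (mul_le_mul_right (hA.lintegral_smoothingGradient_le hd hΩ hc hK
      (hpow (2 * K / cU + 1))) _).trans ?_
    have e : ENNReal.ofReal cU⁻¹ * (24 * (Cd : ℝ≥0∞) ^ 7 * CP * Cd ^ ⌈2 * K / cU + 1⌉₊ *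
        Cd ^ ⌈K⌉₊) = (C₃ cU : ℝ≥0) := by
      simp [C₃, C₂, ENNReal.ofReal]
    rw [← mul_assoc, e]
    gcongr
    exact le_add_self
  refine ⟨v, ⟨hvm, hlocal.trans_lt (ENNReal.mul_lt_top ENNReal.coe_lt_top hnorm)⟩,
    memLipLoc_of_locallyLipschitzOn hloc, hlocal,
    ?_, fun cU hU => ⟨⟨hvm, (huniform cU hU).trans_lt
      (ENNReal.mul_lt_top ENNReal.coe_lt_top hnorm)⟩, huniform cU hU⟩⟩
  filter_upwards [hTu] with x hx
  exact hA.hasTraceAt_smoothing (by finiteness) hd hΩ hc hdΩ hK hum huL x.2 hx
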